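/- Let $p$ be a prime. For a commutative ring $R$, let $V_R$ be the set of binary cubic forms $x(u,v)=x_1u^3+x_2u^2v+x_3uv^2+x_4v^3$ with $x_i\in R$, on which $\mathrm{GL}_2(R)$ acts by $(g\cdot x)(u,v)=\frac1{\det g}\,x(\alpha u+\gamma v,\beta u+\delta v)$ for $g=\begin{pmatrix}\alpha&\beta\\\gamma&\delta\end{pmatrix}$. A form $x\in V_R$ \emph{corresponds} to an $R$-algebra isomorphic to $R\oplus R\omega\oplus R\theta$ with the commutative multiplication $\omega^2=-x_1x_3-x_2\omega+x_1\theta$, $\theta^2=-x_2x_4-x_4\omega+x_3\theta$, $\omega\theta=-x_1x_4$. A cubic ring over $\mathbb Z_p$ is a commutative $\mathbb Z_p$-algebra that is free of rank $3$ as a module; it is \emph{maximal} if it is not isomorphic to a proper subring of another cubic ring over $\mathbb Z_p$. A form over $\mathbb F_p$ has type $(3)$ if it has no root in $\mathbb P^1(\mathbb F_p)$, type $(21)$ if it has exactly one root in $\mathbb P^1(\mathbb F_p)$ and this root is simple, and type $(111)$ if it is nonzero and has three distinct roots in $\mathbb P^1(\mathbb F_p)$. For $(\sigma)=(3),(21),(111)$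 let $V_{p^2}(\sigma)$ be the set of forms over $R=\mathbb Z/p^2\mathbb Z$ whose reduction modulo $p$ has type $(\sigma)$. Let $V_{p^2}(1^3_{\max})$ be the union of the $\mathrm{GL}_2(R)$-orbits of the forms $(a_1,a_2,a_3,a_4)$ with $a_1\in R^\times$, $a_2,a_3\in pR$, $a_4\in pR^\times$, and let $V_{p^2}(1^21_{\max})$ be the union of the $\mathrm{GL}_2(R)$-orbits of the forms $(0,a_2,a_3,a_4)$ with $a_2\in R^\times$, $a_3\in pR$, $a_4\in pR^\times$. For each of these five symbols let $V_{\mathbb Z_p}(\sigma)$ be the set of $x\in V_{\mathbb Z_p}$ with $(x\bmod p^2)\in V_{p^2}(\sigma)$. Then there are an unramified cubic extension $L$ and an unramified quadratic extension $F$ of $\mathbb Q_p$, each unique up to isomorphism over $\mathbb Q_p$, and the following hold, where $\mathcal O$ denotes rings of integers. (1) A $\mathbb Z_p$-algebra is a maximal cubic ring over $\mathbb Z_p$ if and only if it is isomorphic to one of: $\mathcal O_L$; $\mathcal O_F\times\mathbb Z_p$; $\mathbb Z_p^3$; $\mathcal O_{L'}$ for some ramified cubic extension $L'$ of $\mathbb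 Q_p$; $\mathcal O_{F'}\times\mathbb Z_p$ for some ramified quadratic extension $F'$ of $\mathbb Q_p$. (2) A form $x\in V_{\mathbb Z_p}$ corresponds to $\mathcal O_L$, to $\mathcal O_F\times\mathbb Z_p$, to $\mathbb Z_p^3$, to $\mathcal O_{L'}$ for some ramified cubic $L'/\mathbb Q_p$, or to $\mathcal O_{F'}\times\mathbb Z_p$ for some ramified quadratic $F'/\mathbb Q_p$, if and only if $x\in V_{\mathbb Z_p}(\sigma)$ with $(\sigma)=(3)$, $(21)$, $(111)$, $(1^3_{\max})$ or $(1^21_{\max})$, respectively. (3) For $(\sigma)=(3),(21)$ and $(111)$ the set $V_{\mathbb Z_p}(\sigma)$ is a single $\mathrm{GL}_2(\mathbb Z_p)$-orbit. -/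

import Mathlib

open scoped MatrixGroups

universe u

/-- Binary cubic forms `x₁ u³ + x₂ u² v + x₃ u v² + x₄ v³` with coefficients in `R`. -/
@[ext]
structure BinaryCubicForm (R : Type*) where
  x₁ : R
  x₂ : R
  x₃ : R
  x₄ : R

namespace BinaryCubicForm

variable {R S : Type*} [CommRing R] [CommRing S]

/-- The value `x(u, v)`. -/
def eval (x : BinaryCubicForm R) (u v : R) : R :=
  x.x₁ * u ^ 3 + x.x₂ * u ^ 2 * v + x.x₃ * u * v ^ 2 + x.x₄ * v ^ 3

/-- The value of `∂x/∂u` at `(u, v)`. -/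
def evalDu (x : BinaryCubicForm R) (u v : R) : R :=
  3 * x.x₁ * u ^ 2 + 2 * x.x₂ * u * v + x.x₃ * v ^ 2

/-- The value of `∂x/∂v` at `(u, v)`. -/
def evalDv (x : BinaryCubicForm R) (u v : R) : R :=
  x.x₂ * u ^ 2 + 2 * x.x₃ * u * v + 3 * x.x₄ * v ^ 2

/-- Change of coefficients along a ring homomorphism. -/
def map (f : R →+* S) (x : BinaryCubicForm R) : BinaryCubicForm S :=
  ⟨f x.x₁, f x.x₂, f x.x₃, f x.x₄⟩

/-- The twisted action of `GL₂`: for `g = !![α, β; γ, δ]`, the form `g • x` is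
`(det g)⁻¹ x(α u + γ v, β u + δ v)`, written out in coordinates. -/
instance : SMul (GL (Fin 2) R) (BinaryCubicForm R) where
  smul g x :=
    let d : R := ((Matrix.GeneralLinearGroup.det g)⁻¹ : Rˣ)
    let α : R := g 0 0
    let β : R := g 0 1
    let γ : R := g 1 0
    let δ : R := g 1 1
    ⟨d * (α ^ 3 * x.x₁ + α ^ 2 * β * x.x₂ + α * β ^ 2 * x.x₃ + β ^ 3 * x.x₄),
     d * (3 * α ^ 2 * γ * x.x₁ + (α ^ 2 * δ + 2 * α * β * γ) * x.x₂
        + (β ^ 2 * γ + 2 * α * β * δ) * x.x₃ + 3 * β ^ 2 * δ * x.x₄),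
     d * (3 * α * γ ^ 2 * x.x₁ + (β * γ ^ 2 + 2 * α * γ * δ) * x.x₂
        + (α * δ ^ 2 + 2 * β * γ * δ) * x.x₃ + 3 * β * δ ^ 2 * x.x₄),
     d * (γ ^ 3 * x.x₁ + γ ^ 2 * δ * x.x₂ + γ * δ ^ 2 * x.x₃ + δ ^ 3 * x.x₄)⟩

theorem eval_smul (g : GL (Fin 2) R) (x : BinaryCubicForm R) (u v : R) :
    (g • x).eval u v = ((Matrix.GeneralLinearGroup.det g)⁻¹ : Rˣ) *
      x.eval (g 0 0 * u + g 1 0 * v) (g 0 1 * u + g 1 1 * v) := by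
  simp only [eval, HSMul.hSMul, SMul.smul]
  ring

instance : MulAction (GL (Fin 2) R) (BinaryCubicForm R) where
  one_smul x := by
    ext <;> simp [HSMul.hSMul, SMul.smul]
  mul_smul g h x := by
    ext <;>
      simp only [HSMul.hSMul, SMul.smul, map_mul, mul_inv, Units.val_mul, Matrix.mul_apply,
        Fin.sum_univ_two] <;>
      ring

/-- The cubic ring attached to the form `x`: the module `R ⊕ R ω ⊕ R θ`, an element
`⟨a, b, c⟩` standing for `a + b ω + c θ`. -/
@[ext]
structure CubicRing (x : BinaryCubicForm R) where
  a : R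
  b : R
  c : R

namespace CubicRing

variable {x : BinaryCubicForm R}

instance : Zero (CubicRing x) := ⟨⟨0, 0, 0⟩⟩
instance : One (CubicRing x) := ⟨⟨1, 0, 0⟩⟩
instance : Add (CubicRing x) := ⟨fun s t => ⟨s.a + t.a, s.b + t.b, s.c + t.c⟩⟩
instance : Neg (CubicRing x) := ⟨fun s => ⟨-s.a, -s.b, -s.c⟩⟩
instance : Sub (CubicRing x) := ⟨fun s t => ⟨s.a - t.a, s.b - t.b, s.c - t.c⟩⟩
instance : SMul ℕ (CubicRing x) := ⟨fun n s => ⟨n • s.a, n • s.b, n • s.c⟩⟩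
instance : SMul ℤ (CubicRing x) := ⟨fun n s => ⟨n • s.a, n • s.b, n • s.c⟩⟩
instance : SMul R (CubicRing x) := ⟨fun r s => ⟨r * s.a, r * s.b, r * s.c⟩⟩

/-- The bilinear multiplication with `ω² = -x₁x₃ - x₂ω + x₁θ`, `θ² = -x₂x₄ - x₄ω + x₃θ`,
`ωθ = θω = -x₁x₄`. -/
instance : Mul (CubicRing x) :=
  ⟨fun s t =>
    ⟨s.a * t.a - x.x₁ * x.x₃ * (s.b * t.b) - x.x₂ * x.x₄ * (s.c * t.c)
        - x.x₁ * x.x₄ * (s.b * t.c + s.c * t.b),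
     s.a * t.b + s.b * t.a - x.x₂ * (s.b * t.b) - x.x₄ * (s.c * t.c),
     s.a * t.c + s.c * t.a + x.x₁ * (s.b * t.b) + x.x₃ * (s.c * t.c)⟩⟩

@[simp] theorem zero_a : (0 : CubicRing x).a = 0 := rfl
@[simp] theorem zero_b : (0 : CubicRing x).b = 0 := rfl
@[simp] theorem zero_c : (0 : CubicRing x).c = 0 := rfl
@[simp] theorem one_a : (1 : CubicRing x).a = 1 := rfl
@[simp] theorem one_b : (1 : CubicRing x).b = 0 := rfl
@[simp] theorem one_c : (1 : CubicRing x).c = 0 := rfl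
@[simp] theorem add_a (s t : CubicRing x) : (s + t).a = s.a + t.a := rfl
@[simp] theorem add_b (s t : CubicRing x) : (s + t).b = s.b + t.b := rfl
@[simp] theorem add_c (s t : CubicRing x) : (s + t).c = s.c + t.c := rfl
@[simp] theorem neg_a (s : CubicRing x) : (-s).a = -s.a := rfl
@[simp] theorem neg_b (s : CubicRing x) : (-s).b = -s.b := rfl
@[simp] theorem neg_c (s : CubicRing x) : (-s).c = -s.c := rfl
@[simp] theorem smul_a (r : R) (s : CubicRing x) : (r • s).a = r * s.a := rfl
@[simp] theorem smul_b (r : R) (s : CubicRing x) : (r • s).b = r * s.b := rfl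
@[simp] theorem smul_c (r : R) (s : CubicRing x) : (r • s).c = r * s.c := rfl
@[simp] theorem mul_a (s t : CubicRing x) : (s * t).a =
    s.a * t.a - x.x₁ * x.x₃ * (s.b * t.b) - x.x₂ * x.x₄ * (s.c * t.c)
      - x.x₁ * x.x₄ * (s.b * t.c + s.c * t.b) := rfl
@[simp] theorem mul_b (s t : CubicRing x) : (s * t).b =
    s.a * t.b + s.b * t.a - x.x₂ * (s.b * t.b) - x.x₄ * (s.c * t.c) := rfl
@[simp] theorem mul_c (s t : CubicRing x) : (s * t).c =
    s.a * t.c + s.c * t.a + x.x₁ * (s.b * t.b) + x.x₃ * (s.c * t.c) := rfl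

instance : AddCommGroup (CubicRing x) :=
  Function.Injective.addCommGroup (fun s : CubicRing x => (s.a, s.b, s.c))
    (fun _ _ h => CubicRing.ext (congrArg Prod.fst h) (congrArg (fun q => q.2.1) h)
      (congrArg (fun q => q.2.2) h)) rfl (fun _ _ => rfl) (fun _ => rfl) (fun _ _ => rfl)
    (fun _ _ => rfl) (fun _ _ => rfl)

instance : CommRing (CubicRing x) where
  __ := (inferInstance : AddCommGroup (CubicRing x))
  left_distrib _ _ _ := by ext <;> simp <;> ring
  right_distrib _ _ _ := by ext <;> simp <;> ring
  zero_mul _ := by ext <;> simp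
  mul_zero _ := by ext <;> simp
  mul_assoc _ _ _ := by ext <;> simp <;> ring
  one_mul _ := by ext <;> simp
  mul_one _ := by ext <;> simp
  mul_comm _ _ := by ext <;> simp <;> ring

instance : Module R (CubicRing x) where
  one_smul _ := by ext <;> simp
  mul_smul _ _ _ := by ext <;> simp <;> ring
  smul_zero _ := by ext <;> simp
  smul_add _ _ _ := by ext <;> simp <;> ring
  add_smul _ _ _ := by ext <;> simp <;> ring
  zero_smul _ := by ext <;> simp

instance : Algebra R (CubicRing x) :=
  Algebra.ofModule
    (fun _ _ _ => by ext <;> simp <;> ring)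
    (fun _ _ _ => by ext <;> simp <;> ring)

end CubicRing

/-- The form `x` corresponds to the `R`-algebra `A` if the cubic ring attached to `x` is
isomorphic to `A`. -/
def CorrespondsTo (x : BinaryCubicForm R) (A : Type*) [CommRing A] [Algebra R A] : Prop :=
  Nonempty (x.CubicRing ≃ₐ[R] A)

section Field

variable {K : Type*} [Field K]

/-- The set of rational roots of a binary cubic form in the projective line. -/
def rootSet (x : BinaryCubicForm K) : Set (Projectivization K (Fin 2 → K)) :=
  {P | x.eval (P.rep 0) (P.rep 1) = 0}

/-- `P` is a simple root of `x`: the form vanishes at `P`, but its gradient does not. -/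
def IsSimpleRoot (x : BinaryCubicForm K) (P : Projectivization K (Fin 2 → K)) : Prop :=
  P ∈ x.rootSet ∧
    ¬ (x.evalDu (P.rep 0) (P.rep 1) = 0 ∧ x.evalDv (P.rep 0) (P.rep 1) = 0)

end Field

end BinaryCubicForm

/-- The symbols `(3)`, `(21)`, `(111)`, `(1³_max)`, `(1²1_max)`. -/
inductive MaximalType
  | t3
  | t21
  | t111
  | t13max
  | t121max

section Types

variable (p : ℕ) [Fact p.Prime]

/-- Reduction `ℤ/p² → ℤ/p`. -/
def reduceModP : ZMod (p ^ 2) →+* ZMod p :=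
  ZMod.castHom (dvd_pow_self p two_ne_zero) (ZMod p)

/-- Forms over `𝔽_p` of type `(3)`: no rational root. -/
def formsModP3 : Set (BinaryCubicForm (ZMod p)) :=
  {a | a.rootSet = ∅}

/-- Forms over `𝔽_p` of type `(21)`: only one rational root, and that root is simple (so that the
form is the product of a linear form and an irreducible quadratic form). -/
def formsModP21 : Set (BinaryCubicForm (ZMod p)) :=
  {a | ∃ P, a.rootSet = {P} ∧ a.IsSimpleRoot P}

/-- Forms over `𝔽_p` of type `(111)`: nonzero forms with three distinct rational roots. -/
def formsModP111 : Set (BinaryCubicForm (ZMod p)) :=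
  {a | a ≠ ⟨0, 0, 0, 0⟩ ∧ a.rootSet.ncard = 3}

/-- The forms `(0, a₂, a₃, a₄)` over `ℤ/p²` with `a₂` a unit, `a₃ ∈ (p)` and `a₄` equal to `p`
times a unit. -/
def eisenstein121 : Set (BinaryCubicForm (ZMod (p ^ 2))) :=
  {a | a.x₁ = 0 ∧ IsUnit a.x₂ ∧ (p : ZMod (p ^ 2)) ∣ a.x₃ ∧
    ∃ w : ZMod (p ^ 2), IsUnit w ∧ a.x₄ = (p : ZMod (p ^ 2)) * w}

/-- The forms `(a₁, a₂, a₃, a₄)` over `ℤ/p²` with `a₁` a unit, `a₂, a₃ ∈ (p)` and `a₄` equal to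
`p` times a unit. -/
def eisenstein13 : Set (BinaryCubicForm (ZMod (p ^ 2))) :=
  {a | IsUnit a.x₁ ∧ (p : ZMod (p ^ 2)) ∣ a.x₂ ∧ (p : ZMod (p ^ 2)) ∣ a.x₃ ∧
    ∃ w : ZMod (p ^ 2), IsUnit w ∧ a.x₄ = (p : ZMod (p ^ 2)) * w}

/-- The set `V_{p²}(σ)` of binary cubic forms over `ℤ/p²` of type `σ`. -/
def formsModPSq : MaximalType → Set (BinaryCubicForm (ZMod (p ^ 2)))
  | .t3 => {a | a.map (reduceModP p) ∈ formsModP3 p}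
  | .t21 => {a | a.map (reduceModP p) ∈ formsModP21 p}
  | .t111 => {a | a.map (reduceModP p) ∈ formsModP111 p}
  | .t13max => {a | ∃ g : GL (Fin 2) (ZMod (p ^ 2)), ∃ b ∈ eisenstein13 p, a = g • b}
  | .t121max => {a | ∃ g : GL (Fin 2) (ZMod (p ^ 2)), ∃ b ∈ eisenstein121 p, a = g • b}

/-- The set `V_{ℤ_p}(σ)` of binary cubic forms over `ℤ_p` whose reduction modulo `p²` is of
type `σ`. -/
def padicForms (σ : MaximalType) : Set (BinaryCubicForm ℤ_[p]) :=
  {x | x.map (PadicInt.toZModPow 2) ∈ formsModPSq p σ}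

/-- A commutative `ℤ_p`-algebra is a cubic ring if it is free of rank `3` as a module. -/
def IsCubicRing (A : Type*) [CommRing A] [Algebra ℤ_[p] A] : Prop :=
  Nonempty (Module.Basis (Fin 3) ℤ_[p] A)

/-- A cubic ring over `ℤ_p` is maximal if it is not isomorphic to a proper subring of another
cubic ring. -/
structure IsMaximalCubicRing (A : Type u) [CommRing A] [Algebra ℤ_[p] A] : Prop where
  isCubicRing : IsCubicRing p A
  eq_top_of_equiv : ∀ (B : Type u) [CommRing B] [Algebra ℤ_[p] B], IsCubicRing p B →
    ∀ T : Subalgebra ℤ_[p] B, Nonempty (A ≃ₐ[ℤ_[p]] T) → T = ⊤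

end Types

/-- An extension field of `ℚ_p` of degree `n`. -/
structure PadicExtension (p : ℕ) [Fact p.Prime] (n : ℕ) where
  carrier : Type u
  [field : Field carrier]
  [algebra : Algebra ℚ_[p] carrier]
  [finite : FiniteDimensional ℚ_[p] carrier]
  finrank_eq : Module.finrank ℚ_[p] carrier = n

namespace PadicExtension

variable {p : ℕ} [Fact p.Prime] {n : ℕ}

attribute [instance] PadicExtension.field PadicExtension.algebra PadicExtension.finite

/-- `ℤ_p` acts on an extension of `ℚ_p` through `ℤ_p ⊆ ℚ_p`. -/
noncomputable instance (L : PadicExtension p n) : Algebra ℤ_[p] L.carrier :=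
  ((algebraMap ℚ_[p] L.carrier).comp (algebraMap ℤ_[p] ℚ_[p])).toAlgebra

instance (L : PadicExtension p n) : IsScalarTower ℤ_[p] ℚ_[p] L.carrier :=
  IsScalarTower.of_algebraMap_eq' rfl

/-- The integer ring `𝒪_L`, the integral closure of `ℤ_p` in `L`. -/
noncomputable abbrev integers (L : PadicExtension p n) : Subalgebra ℤ_[p] L.carrier :=
  integralClosure ℤ_[p] L.carrier

/-- `L` is unramified over `ℚ_p`: its integer ring is an unramified `ℤ_p`-algebra. The extension
is called ramified if it is not unramified. -/
def IsUnramified (L : PadicExtension p n) : Prop :=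
  Algebra.Unramified ℤ_[p] L.integers

end PadicExtension

/-! The bridge is the Delone–Faddeev correspondence. In a cubic ring a basis `1, w, t` can be
translated by scalars until `w t` is a scalar, and associativity then forces the multiplication
table to be that of a form. Two forms give isomorphic rings exactly when they are `GL₂`-equivalent
(`exists_correspondsTo_of_basis`, `nonempty_algEquiv_iff`). The classification of maximal rings thus
becomes an analysis of forms over `ℤ_p` up to equivalence.

Modulo `p` a form is zero, has no root, has a simple root, or is nonzero with roots that are all
multiple. Hensel's lemma lifts a simple root to a linear factor, which brings the form to `(0, 1, b,
c)`. Examining the quadratic factor there, and the triple root in the last case, shows that every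
form is either in one of the five sets or is `IsReducible`, in which case its ring embeds properly
in another cubic ring (`isReducible_or_mem_padicForms`, `IsMaximalCubicRing.not_isReducible`). So
the form of a maximal ring has one of the five types.

Conversely, `(1, b, c, d)` gives `ℤ_p[X]/(X³ + bX² + cX + d)`, `(0, 1, b, c)` gives `ℤ_p[X]/(X² - bX
+ c) × ℤ_p`, and `(0, 1, -1, 0)` gives `ℤ_p³`. If the polynomial is irreducible modulo `p`, or
Eisenstein, the quotient is the integer ring of an unramified, respectively ramified, extension. All
these rings are maximal because they are integrally closed in the algebra obtained by inverting `p`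
(`IsMaximalCubicRing.of_isIntegral_mem_range`).

Finally, polynomials of one degree that are irreducible modulo `p` define isomorphic rings, again by
Hensel (`nonempty_adjoinRoot_algEquiv`). This gives uniqueness of the unramified extensions. Each of
the types `(3)`, `(21)`, `(111)` therefore belongs to a single ring, hence to a single orbit. -/

set_option linter.unusedSimpArgs false

/-! ### The Delone–Faddeev correspondence over an arbitrary commutative ring. -/

namespace BinaryCubicForm

section DeloneFaddeev

variable {R : Type*} [CommRing R]

namespace CubicRing

variable {x y : BinaryCubicForm R}

@[simp] theorem algebraMap_a (r : R) : (algebraMap R (CubicRing x) r).a = r := by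
  simp [Algebra.algebraMap_eq_smul_one]

@[simp] theorem algebraMap_b (r : R) : (algebraMap R (CubicRing x) r).b = 0 := by
  simp [Algebra.algebraMap_eq_smul_one]

@[simp] theorem algebraMap_c (r : R) : (algebraMap R (CubicRing x) r).c = 0 := by
  simp [Algebra.algebraMap_eq_smul_one]

@[simp] theorem sub_a (s t : CubicRing x) : (s - t).a = s.a - t.a := rfl
@[simp] theorem sub_b (s t : CubicRing x) : (s - t).b = s.b - t.b := rfl
@[simp] theorem sub_c (s t : CubicRing x) : (s - t).c = s.c - t.c := rfl

/-- The coordinates `(a, b, c)` of `a + b ω + c θ`. -/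
def coords (x : BinaryCubicForm R) : CubicRing x ≃ₗ[R] (Fin 3 → R) where
  toFun s := ![s.a, s.b, s.c]
  invFun f := ⟨f 0, f 1, f 2⟩
  map_add' s t := by ext i; fin_cases i <;> simp
  map_smul' r s := by ext i; fin_cases i <;> simp
  left_inv s := by ext <;> simp
  right_inv f := by ext i; fin_cases i <;> simp

/-- The basis `1, ω, θ`. -/
noncomputable def basis (x : BinaryCubicForm R) : Module.Basis (Fin 3) R (CubicRing x) :=
  Module.Basis.ofEquivFun (coords x)

variable {A : Type*} [CommRing A] [Algebra R A]

/-- The algebra map out of a cubic ring determined by the images of `ω` and `θ`. -/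
noncomputable def lift (x : BinaryCubicForm R) (w t : A)
    (hww : w * w = -algebraMap R A (x.x₁ * x.x₃) - x.x₂ • w + x.x₁ • t)
    (hwt : w * t = -algebraMap R A (x.x₁ * x.x₄))
    (htt : t * t = -algebraMap R A (x.x₂ * x.x₄) - x.x₄ • w + x.x₃ • t) :
    CubicRing x →ₐ[R] A :=
  AlgHom.ofLinearMap
    { toFun := fun s => algebraMap R A s.a + s.b • w + s.c • t
      map_add' := fun s t => by simp [add_smul]; ring
      map_smul' := fun r s => by simp [Algebra.smul_def]; ring }
    (by simp)
    (fun s s' => by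
      simp only [LinearMap.coe_mk, AddHom.coe_mk, mul_a, mul_b, mul_c]
      simp only [Algebra.smul_def, map_add, map_sub, map_mul] at hww hwt htt ⊢
      linear_combination (-algebraMap R A s.b * algebraMap R A s'.b) * hww
        - (algebraMap R A s.b * algebraMap R A s'.c + algebraMap R A s.c * algebraMap R A s'.b)
          * hwt - algebraMap R A s.c * algebraMap R A s'.c * htt)

theorem lift_apply (x : BinaryCubicForm R) (w t : A) (hww hwt htt) (s : CubicRing x) :
    lift x w t hww hwt htt s = algebraMap R A s.a + s.b • w + s.c • t := rfl

end CubicRing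

open CubicRing

/-- An algebra with a basis `1, w, t` such that `w t` is a scalar is the cubic ring of a form. -/
theorem exists_correspondsTo_of_basis {A : Type*} [CommRing A] [Algebra R A]
    (b : Module.Basis (Fin 3) R A) (h0 : b 0 = 1) :
    ∃ x : BinaryCubicForm R, x.CorrespondsTo A := by
  have hrep (z : A) : z = algebraMap R A (b.repr z 0) + b.repr z 1 • b 1 + b.repr z 2 • b 2 := by
    conv_lhs => rw [← b.sum_repr z]
    rw [Fin.sum_univ_three, h0, Algebra.algebraMap_eq_smul_one]
  have hind (r s t : R) (h : algebraMap R A r + s • b 1 + t • b 2 = 0) : r = 0 ∧ s = 0 ∧ t = 0 := by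
    have := Fintype.linearIndependent_iff.1 b.linearIndependent ![r, s, t]
      (by rw [Fin.sum_univ_three, h0, ← h, Algebra.algebraMap_eq_smul_one]; simp)
    exact ⟨this 0, this 1, this 2⟩
  -- Subtracting from each generator the coefficient of the other one in `b 1 * b 2` removes both
  -- linear terms of the product.
  set c := b.repr (b 1 * b 2) with hc
  set w := b 1 - algebraMap R A (c 2) with hw
  set t := b 2 - algebraMap R A (c 1) with ht
  have hrep' (z : A) : ∃ r s v : R, z = algebraMap R A r + s • w + v • t := by
    refine ⟨b.repr z 0 + b.repr z 1 * c 2 + b.repr z 2 * c 1, b.repr z 1, b.repr z 2, ?_⟩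
    conv_lhs => rw [hrep z]
    simp only [hw, ht, Algebra.smul_def, map_add, map_mul]
    ring
  have hind' (r s v : R) (h : algebraMap R A r + s • w + v • t = 0) : r = 0 ∧ s = 0 ∧ v = 0 := by
    obtain ⟨h1, h2, h3⟩ := hind (r - s * c 2 - v * c 1) s v (by
      rw [← h]
      simp only [hw, ht, Algebra.smul_def, map_sub, map_mul]
      ring)
    subst h2 h3
    simpa using h1
  obtain ⟨n, hn⟩ : ∃ n : R, w * t = algebraMap R A n := by
    refine ⟨c 0 + c 1 * c 2, ?_⟩
    have := hrep (b 1 * b 2)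
    rw [← hc] at this
    simp only [hw, ht, Algebra.smul_def, map_add, map_mul] at this ⊢
    linear_combination this
  obtain ⟨p0, p1, p2, hp⟩ := hrep' (w * w)
  obtain ⟨q0, q1, q2, hq⟩ := hrep' (t * t)
  -- Compare coefficients in `(w w) t = w (w t)`, and next in `(t t) w = t (t w)`. This determines
  -- all constant terms from `p1, p2, q1, q2`, which become the coefficients of the form up to sign.
  obtain ⟨e1, e2, e3⟩ := hind' (p1 * n + p2 * q0) (p2 * q1 - n) (p0 + p2 * q2) (by
    simp only [Algebra.smul_def, map_add, map_sub, map_mul] at hp hq hn ⊢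
    linear_combination (-t) * hp - algebraMap R A p2 * hq - algebraMap R A p1 * hn + w * hn)
  obtain ⟨e4, e5, e6⟩ := hind' (q1 * p0 + q2 * n) (q0 + q1 * p1) (q1 * p2 - n) (by
    simp only [Algebra.smul_def, map_add, map_sub, map_mul] at hp hq hn ⊢
    linear_combination (-w) * hq - algebraMap R A q1 * hp - algebraMap R A q2 * hn + t * hn)
  have key (x : BinaryCubicForm R) (hx : x = ⟨p2, -p1, q2, -q1⟩) : x.CorrespondsTo A := by
    have h1 : x.x₁ = p2 := by rw [hx]
    have h2 : x.x₂ = -p1 := by rw [hx]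
    have h3 : x.x₃ = q2 := by rw [hx]
    have h4 : x.x₄ = -q1 := by rw [hx]
    refine ⟨AlgEquiv.ofBijective (CubicRing.lift x w t ?_ ?_ ?_) ⟨?_, ?_⟩⟩
    · rw [hp, h1, h2, h3, show p0 = -(p2 * q2) by linear_combination e3]; simp
    · rw [hn, h1, h4, show n = p2 * q1 by linear_combination -e2]; simp
    · rw [hq, h2, h3, h4, show q0 = -(q1 * p1) by linear_combination e5]; simp; ring
    · rw [injective_iff_map_eq_zero]
      intro s hs
      obtain ⟨a1, a2, a3⟩ := hind' _ _ _ hs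
      ext <;> simp [a1, a2, a3]
    · intro z
      obtain ⟨r, s, v, h⟩ := hrep' z
      exact ⟨⟨r, s, v⟩, h.symm⟩
  exact ⟨_, key _ rfl⟩

theorem smul_x₁ (g : GL (Fin 2) R) (x : BinaryCubicForm R) : (g • x).x₁ =
    ((Matrix.GeneralLinearGroup.det g)⁻¹ : Rˣ) * x.eval (g 0 0) (g 0 1) := by
  simp only [HSMul.hSMul, SMul.smul, eval]
  ring

theorem smul_x₄ (g : GL (Fin 2) R) (x : BinaryCubicForm R) : (g • x).x₄ =
    ((Matrix.GeneralLinearGroup.det g)⁻¹ : Rˣ) * x.eval (g 1 0) (g 1 1) := by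
  simp only [HSMul.hSMul, SMul.smul, eval]
  ring

theorem smul_x₂ (g : GL (Fin 2) R) (x : BinaryCubicForm R) : (g • x).x₂ =
    ((Matrix.GeneralLinearGroup.det g)⁻¹ : Rˣ) *
      (x.evalDu (g 0 0) (g 0 1) * g 1 0 + x.evalDv (g 0 0) (g 0 1) * g 1 1) := by
  simp only [HSMul.hSMul, SMul.smul, evalDu, evalDv]
  ring

theorem smul_x₃ (g : GL (Fin 2) R) (x : BinaryCubicForm R) : (g • x).x₃ =
    ((Matrix.GeneralLinearGroup.det g)⁻¹ : Rˣ) *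
      (x.evalDu (g 1 0) (g 1 1) * g 0 0 + x.evalDv (g 1 0) (g 1 1) * g 0 1) := by
  simp only [HSMul.hSMul, SMul.smul, evalDu, evalDv]
  ring

theorem det_inv_mul (g : GL (Fin 2) R) : (((Matrix.GeneralLinearGroup.det g)⁻¹ : Rˣ) : R) *
    (g 0 0 * g 1 1 - g 0 1 * g 1 0) = 1 := by
  have := Units.inv_mul (Matrix.GeneralLinearGroup.det g)
  rwa [Matrix.GeneralLinearGroup.val_det_apply, Matrix.det_fin_two] at this

theorem eq_smul_of_matrix {x y : BinaryCubicForm R} (g : GL (Fin 2) R)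
    (h₁ : x.x₁ * (g 0 0 * g 1 1 - g 0 1 * g 1 0) = y.eval (g 0 0) (g 0 1))
    (h₂ : x.x₂ * (g 0 0 * g 1 1 - g 0 1 * g 1 0) =
      y.evalDu (g 0 0) (g 0 1) * g 1 0 + y.evalDv (g 0 0) (g 0 1) * g 1 1)
    (h₃ : x.x₃ * (g 0 0 * g 1 1 - g 0 1 * g 1 0) =
      y.evalDu (g 1 0) (g 1 1) * g 0 0 + y.evalDv (g 1 0) (g 1 1) * g 0 1)
    (h₄ : x.x₄ * (g 0 0 * g 1 1 - g 0 1 * g 1 0) = y.eval (g 1 0) (g 1 1)) : x = g • y := by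
  have hd := det_inv_mul g
  ext
  · rw [smul_x₁, ← h₁]; linear_combination (-x.x₁) * hd
  · rw [smul_x₂, ← h₂]; linear_combination (-x.x₂) * hd
  · rw [smul_x₃, ← h₃]; linear_combination (-x.x₃) * hd
  · rw [smul_x₄, ← h₄]; linear_combination (-x.x₄) * hd

/-- Forms with isomorphic cubic rings are equivalent. -/
theorem exists_eq_smul_of_algEquiv {x y : BinaryCubicForm R} (e : CubicRing x ≃ₐ[R] CubicRing y) :
    ∃ g : GL (Fin 2) R, x = g • y := by
  have hlin {x y : BinaryCubicForm R} (f : CubicRing x ≃ₐ[R] CubicRing y) (s : CubicRing x) :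
      f s = s.a • 1 + s.b • f ⟨0, 1, 0⟩ + s.c • f ⟨0, 0, 1⟩ := by
    rw [← map_one f, ← map_smul, ← map_smul, ← map_smul, ← map_add, ← map_add]
    congr 1
    ext <;> simp
  set W := e ⟨0, 1, 0⟩ with hW
  set T := e ⟨0, 0, 1⟩ with hT
  have hWW := map_mul e ⟨0, 1, 0⟩ ⟨0, 1, 0⟩
  have hWT := map_mul e ⟨0, 1, 0⟩ ⟨0, 0, 1⟩
  have hTT := map_mul e ⟨0, 0, 1⟩ ⟨0, 0, 1⟩
  rw [hlin] at hWW hWT hTT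
  rw [← hW, ← hT] at hWW hWT hTT
  have i1 : e.symm W = ⟨0, 1, 0⟩ := by simp [hW]
  have i2 : e.symm T = ⟨0, 0, 1⟩ := by simp [hT]
  rw [hlin] at i1 i2
  set W' := e.symm ⟨0, 1, 0⟩
  set T' := e.symm ⟨0, 0, 1⟩
  simp only [CubicRing.ext_iff, add_a, add_b, add_c, sub_a, sub_b, sub_c, smul_a, smul_b, smul_c, mul_a, mul_b, mul_c,
    one_a, one_b, one_c] at hWW hWT hTT i1 i2
  -- The matrix is that of `e` on the quotients of the rings by the scalars, so `e.symm` supplies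
  -- its inverse.
  have hmul : (!![W.b, W.c; T.b, T.c] : Matrix (Fin 2) (Fin 2) R) * !![W'.b, W'.c; T'.b, T'.c] = 1 := by
    rw [Matrix.mul_fin_two, Matrix.one_fin_two]
    obtain ⟨-, i3, i4⟩ := i1
    obtain ⟨-, i5, i6⟩ := i2
    simp only [mul_zero, zero_add] at i3 i4 i5 i6
    rw [i3, i4, i5, i6]
  let g : GL (Fin 2) R := ⟨_, _, hmul, mul_eq_one_comm.1 hmul⟩
  have g00 : g 0 0 = W.b := rfl
  have g01 : g 0 1 = W.c := rfl
  have g10 : g 1 0 = T.b := rfl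
  have g11 : g 1 1 = T.c := rfl
  obtain ⟨-, a1, a2⟩ := hWW
  obtain ⟨-, b1, b2⟩ := hWT
  obtain ⟨-, c1, c2⟩ := hTT
  -- Cramer's rule: the `ω`- and `θ`-coordinates of the three product relations are linear equations
  -- in the coefficients of `x`. The scalar coordinates are not needed.
  refine ⟨g, eq_smul_of_matrix g ?_ ?_ ?_ ?_⟩ <;>
    simp only [g00, g01, g10, g11, eval, evalDu, evalDv]
  · linear_combination W.b * a2 - W.c * a1
  · linear_combination (-T.c) * a1 + T.b * a2 - 2 * W.c * b1 + 2 * W.b * b2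
  · linear_combination (-2 * T.c) * b1 + 2 * T.b * b2 - W.c * c1 + W.b * c2
  · linear_combination T.b * c2 - T.c * c1

/-- Equivalent forms have isomorphic cubic rings. -/
theorem nonempty_algEquiv_smul (g : GL (Fin 2) R) (y : BinaryCubicForm R) :
    Nonempty (CubicRing (g • y) ≃ₐ[R] CubicRing y) := by
  have h := det_inv_mul g
  have h₁ := smul_x₁ g y
  have h₂ := smul_x₂ g y
  have h₃ := smul_x₃ g y
  have h₄ := smul_x₄ g y
  generalize (((Matrix.GeneralLinearGroup.det g)⁻¹ : Rˣ) : R) = d at *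
  generalize g • y = x at *
  generalize g 0 0 = α at *
  generalize g 0 1 = β at *
  generalize g 1 0 = γ at *
  generalize g 1 1 = δ at *
  simp only [eval, evalDu, evalDv] at h₁ h₂ h₃ h₄
  -- The scalar parts of `w` and `t` solve the 2 × 2 system that makes the `ω`- and `θ`-coordinates
  -- of `w * t` vanish.
  let w : CubicRing y := ⟨-d * ((y.x₂ * α * γ + y.x₄ * β * δ) * β
    + (y.x₁ * α * γ + y.x₃ * β * δ) * α), α, β⟩
  let t : CubicRing y := ⟨d * ((y.x₂ * α * γ + y.x₄ * β * δ) * δ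
    + (y.x₁ * α * γ + y.x₃ * β * δ) * γ), γ, δ⟩
  refine ⟨AlgEquiv.ofBijective (CubicRing.lift x w t ?_ ?_ ?_) ⟨?_, ?_⟩⟩
  · ext <;> simp only [w, t, h₁, h₂, h₃, mul_a, mul_b, mul_c, add_a, add_b, add_c, sub_a, sub_b, sub_c,
      neg_a, neg_b, neg_c, smul_a, smul_b, smul_c, algebraMap_a, algebraMap_b, algebraMap_c]
    · linear_combination (y.x₁ * y.x₃ * α ^ 2 + y.x₂ * y.x₄ * β ^ 2 + 2 * y.x₁ * y.x₄ * α * β)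
        * (d * (α * δ - β * γ) + 1) * h
    · linear_combination (y.x₂ * α ^ 2 + y.x₄ * β ^ 2) * h
    · linear_combination (-(y.x₁ * α ^ 2 + y.x₃ * β ^ 2)) * h
  · ext <;> simp only [w, t, h₁, h₄, mul_a, mul_b, mul_c, add_a, add_b, add_c, sub_a, sub_b, sub_c,
      neg_a, neg_b, neg_c, smul_a, smul_b, smul_c, algebraMap_a, algebraMap_b, algebraMap_c]
    · linear_combination (y.x₁ * y.x₃ * α * γ + y.x₂ * y.x₄ * β * δ
        + y.x₁ * y.x₄ * (α * δ + β * γ)) * (d * (α * δ - β * γ) + 1) * h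
    · linear_combination (y.x₂ * α * γ + y.x₄ * β * δ) * h
    · linear_combination (-(y.x₁ * α * γ + y.x₃ * β * δ)) * h
  · ext <;> simp only [w, t, h₂, h₃, h₄, mul_a, mul_b, mul_c, add_a, add_b, add_c, sub_a, sub_b, sub_c,
      neg_a, neg_b, neg_c, smul_a, smul_b, smul_c, algebraMap_a, algebraMap_b, algebraMap_c]
    · linear_combination (y.x₁ * y.x₃ * γ ^ 2 + y.x₂ * y.x₄ * δ ^ 2 + 2 * y.x₁ * y.x₄ * γ * δ)
        * (d * (α * δ - β * γ) + 1) * h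
    · linear_combination (y.x₂ * γ ^ 2 + y.x₄ * δ ^ 2) * h
    · linear_combination (-(y.x₁ * γ ^ 2 + y.x₃ * δ ^ 2)) * h
  · rw [injective_iff_map_eq_zero]
    intro s hs
    rw [CubicRing.lift_apply, CubicRing.ext_iff] at hs
    simp [w, t] at hs
    obtain ⟨ha, hb, hc⟩ := hs
    have b0 : s.b = 0 := by linear_combination d * δ * hb - d * γ * hc - s.b * h
    have c0 : s.c = 0 := by linear_combination d * α * hc - d * β * hb - s.c * h
    ext
    · simpa [b0, c0] using ha
    · exact b0
    · exact c0
  · intro s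
    refine ⟨⟨s.a - d * (s.b * δ - s.c * γ) * w.a - d * (s.c * α - s.b * β) * t.a,
      d * (s.b * δ - s.c * γ), d * (s.c * α - s.b * β)⟩, ?_⟩
    rw [CubicRing.lift_apply]
    ext <;> simp
    · ring
    · simp [w, t]
      linear_combination s.b * h
    · simp [w, t]
      linear_combination s.c * h

theorem nonempty_algEquiv_iff {x y : BinaryCubicForm R} :
    Nonempty (CubicRing x ≃ₐ[R] CubicRing y) ↔ ∃ g : GL (Fin 2) R, x = g • y :=
  ⟨fun ⟨e⟩ => exists_eq_smul_of_algEquiv e, fun ⟨g, hg⟩ => hg ▸ nonempty_algEquiv_smul g y⟩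

theorem correspondsTo_smul_iff {A : Type*} [CommRing A] [Algebra R A] (g : GL (Fin 2) R)
    (x : BinaryCubicForm R) : (g • x).CorrespondsTo A ↔ x.CorrespondsTo A := by
  obtain ⟨e⟩ := nonempty_algEquiv_smul g x
  exact ⟨fun ⟨f⟩ => ⟨e.symm.trans f⟩, fun ⟨f⟩ => ⟨e.trans f⟩⟩

theorem CorrespondsTo.exists_eq_smul {A : Type*} [CommRing A] [Algebra R A]
    {x y : BinaryCubicForm R} (hx : x.CorrespondsTo A) (hy : y.CorrespondsTo A) :
    ∃ g : GL (Fin 2) R, x = g • y :=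
  nonempty_algEquiv_iff.1 (hx.elim fun e => hy.elim fun f => ⟨e.trans f.symm⟩)

end DeloneFaddeev

end BinaryCubicForm

/-! ### Cubic rings of forms in normal shape, and explicit overrings. -/

theorem LinearMap.bijective_of_surjective_of_finrank_eq {R M N : Type*} [CommRing R] [Nontrivial R]
    [AddCommGroup M] [Module R M] [Module.Free R M] [Module.Finite R M]
    [AddCommGroup N] [Module R N] [Module.Free R N] [Module.Finite R N]
    (h : Module.finrank R M = Module.finrank R N) (f : M →ₗ[R] N) (hf : Function.Surjective f) :
    Function.Bijective f := by
  let e := LinearEquiv.ofFinrankEq M N h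
  have := OrzechProperty.bijective_of_surjective_endomorphism (e.symm.toLinearMap ∘ₗ f)
    (by simpa using hf)
  simpa using this

open Polynomial in
theorem AdjoinRoot.finrank_eq_natDegree {R : Type*} [CommRing R] [Nontrivial R] {f : R[X]}
    (hf : f.Monic) : Module.finrank R (AdjoinRoot f) = f.natDegree := by
  rw [(AdjoinRoot.powerBasis' hf).finrank, AdjoinRoot.powerBasis'_dim]

namespace BinaryCubicForm

open Polynomial CubicRing

section NormalForms

variable {R : Type*} [CommRing R]

theorem CubicRing.algHom_ext {x : BinaryCubicForm R} {A : Type*} [CommRing A] [Algebra R A]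
    {f g : CubicRing x →ₐ[R] A} (h₁ : f ⟨0, 1, 0⟩ = g ⟨0, 1, 0⟩) (h₂ : f ⟨0, 0, 1⟩ = g ⟨0, 0, 1⟩) :
    f = g := by
  have hlin (f : CubicRing x →ₐ[R] A) (s : CubicRing x) :
      f s = s.a • 1 + s.b • f ⟨0, 1, 0⟩ + s.c • f ⟨0, 0, 1⟩ := by
    rw [← map_one f, ← map_smul, ← map_smul, ← map_smul, ← map_add, ← map_add]
    congr 1
    ext <;> simp
  ext s
  rw [hlin f, hlin g, h₁, h₂]

/-- The monic cubic polynomial `X³ + b X² + c X + d`. -/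
noncomputable def monicCubic (b c d : R) : R[X] := X ^ 3 + C b * X ^ 2 + C c * X + C d

/-- The monic quadratic polynomial `X² - b X + c`. -/
noncomputable def monicQuadratic (b c : R) : R[X] := X ^ 2 - C b * X + C c

theorem monic_monicCubic (b c d : R) : (monicCubic b c d).Monic := by
  rw [monicCubic]; monicity!

theorem monic_monicQuadratic (b c : R) : (monicQuadratic b c).Monic := by
  rw [monicQuadratic]; monicity!

theorem natDegree_monicCubic [Nontrivial R] (b c d : R) : (monicCubic b c d).natDegree = 3 := by
  rw [monicCubic]; compute_degree!

theorem natDegree_monicQuadratic [Nontrivial R] (b c : R) :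
    (monicQuadratic b c).natDegree = 2 := by
  rw [monicQuadratic]; compute_degree!

/-- Send `ω` to the root `ρ` and `θ` to `ρ² + bρ + c`. Then `ωθ = -d` is the equation of `ρ`, and
`ω²` expresses `θ` through `ω`, so `ω` generates the ring. -/
theorem correspondsTo_adjoinRoot_monicCubic (b c d : R) :
    (⟨1, b, c, d⟩ : BinaryCubicForm R).CorrespondsTo (AdjoinRoot (monicCubic b c d)) := by
  set f := monicCubic b c d with hf
  set ρ := AdjoinRoot.root f
  have hρ : ρ ^ 3 + algebraMap R _ b * ρ ^ 2 + algebraMap R _ c * ρ + algebraMap R _ d = 0 := by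
    have : aeval ρ (monicCubic b c d) = 0 := by rw [← hf, AdjoinRoot.aeval_eq, AdjoinRoot.mk_self]
    simpa only [monicCubic, map_add, map_sub, map_mul, map_pow, aeval_C, aeval_X] using this
  let φ : CubicRing (⟨1, b, c, d⟩ : BinaryCubicForm R) →ₐ[R] AdjoinRoot f :=
    CubicRing.lift _ ρ (ρ ^ 2 + b • ρ + algebraMap R _ c)
      (by simp [Algebra.smul_def, -AdjoinRoot.algebraMap_eq]; ring)
      (by simp [Algebra.smul_def, -AdjoinRoot.algebraMap_eq]; linear_combination hρ)
      (by simp [Algebra.smul_def, -AdjoinRoot.algebraMap_eq]; linear_combination (ρ + algebraMap R _ b) * hρ)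
  let ψ : AdjoinRoot f →ₐ[R] CubicRing (⟨1, b, c, d⟩ : BinaryCubicForm R) :=
    AdjoinRoot.liftAlgHom f (Algebra.ofId _ _) ⟨0, 1, 0⟩ (by
      rw [← AlgHom.toRingHom_eq_coe, hf, monicCubic]
      simp [pow_succ, Algebra.ofId_apply]
      ext <;> simp
      ring)
  have h1 : φ ⟨0, 1, 0⟩ = ρ := by simp [φ, CubicRing.lift_apply]
  have h2 : ψ ρ = ⟨0, 1, 0⟩ := by simp [ψ, ρ]
  refine ⟨AlgEquiv.ofAlgHom φ ψ (AdjoinRoot.algHom_ext (by simp [h1, h2, ρ])) ?_⟩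
  apply CubicRing.algHom_ext
  · simp [h1, h2]
  · have : (⟨0, 0, 1⟩ : CubicRing (⟨1, b, c, d⟩ : BinaryCubicForm R)) = ⟨0, 1, 0⟩ ^ 2
        + b • ⟨0, 1, 0⟩ + algebraMap R _ c := by
      rw [pow_two]
      ext <;> simp
    rw [this]
    simp [h1, h2, -AdjoinRoot.algebraMap_eq]

/-- Here `ω² = -ω`, so `-ω` is an idempotent and splits off a factor `R`. On the other factor `θ`
satisfies `θ² = bθ - c`; the sign of `b` is opposite to the one in the dehomogenised form. -/
theorem correspondsTo_adjoinRoot_monicQuadratic_prod [Nontrivial R] (b c : R) :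
    (⟨0, 1, b, c⟩ : BinaryCubicForm R).CorrespondsTo (AdjoinRoot (monicQuadratic b c) × R) := by
  have hmonic := monic_monicQuadratic b c
  have hdeg := natDegree_monicQuadratic b c
  set f := monicQuadratic b c with hf
  set ρ := AdjoinRoot.root f
  have hρ : ρ ^ 2 - algebraMap R _ b * ρ + algebraMap R _ c = 0 := by
    have : aeval ρ (monicQuadratic b c) = 0 := by rw [← hf, AdjoinRoot.aeval_eq, AdjoinRoot.mk_self]
    simpa only [monicQuadratic, map_add, map_sub, map_mul, map_pow, aeval_C, aeval_X] using this
  let φ : CubicRing (⟨0, 1, b, c⟩ : BinaryCubicForm R) →ₐ[R] AdjoinRoot f × R :=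
    CubicRing.lift _ (0, -1) (ρ, 0)
      (by ext <;> simp) (by ext <;> simp)
      (by
        ext <;> simp [Algebra.smul_def, -AdjoinRoot.algebraMap_eq]
        linear_combination hρ)
  have hsurj : Function.Surjective φ := by
    intro ⟨z, r⟩
    obtain ⟨P, rfl⟩ := AdjoinRoot.mk_surjective z
    -- `1 + ω` and `-ω` map to the idempotents `(1, 0)` and `(0, 1)`.
    refine ⟨⟨1, 1, 0⟩ * aeval ⟨0, 0, 1⟩ P + r • ⟨0, -1, 0⟩, ?_⟩
    rw [map_add, map_mul, ← aeval_algHom_apply, map_smul]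
    ext
    · have h1 : (φ ⟨0, 0, 1⟩).1 = ρ := by simp [φ, CubicRing.lift_apply]
      have h2 : (aeval (φ ⟨0, 0, 1⟩) P).1 = AdjoinRoot.mk f P := by
        rw [← AlgHom.fst_apply (R := R), ← aeval_algHom_apply, AlgHom.fst_apply, h1,
          AdjoinRoot.aeval_eq]
      simp [h2]
      simp [φ, CubicRing.lift_apply]
    · simp [φ, CubicRing.lift_apply]
  have := hmonic.free_adjoinRoot
  have := hmonic.finite_adjoinRoot
  have : Module.Free R (CubicRing (⟨0, 1, b, c⟩ : BinaryCubicForm R)) := .of_basis (basis _)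
  have : Module.Finite R (CubicRing (⟨0, 1, b, c⟩ : BinaryCubicForm R)) := .of_basis (basis _)
  refine ⟨AlgEquiv.ofBijective φ
    (LinearMap.bijective_of_surjective_of_finrank_eq ?_ φ.toLinearMap hsurj)⟩
  rw [Module.finrank_prod, AdjoinRoot.finrank_eq_natDegree hmonic, hdeg, Module.finrank_self,
    Module.finrank_eq_card_basis (basis _), Fintype.card_fin]

/-- For the form `uv(u - v)` the elements `-ω` and `-θ` are orthogonal idempotents. -/
theorem correspondsTo_fin_three :
    (⟨0, 1, -1, 0⟩ : BinaryCubicForm R).CorrespondsTo (Fin 3 → R) := by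
  refine ⟨AlgEquiv.ofBijective (CubicRing.lift _ ![0, -1, 0] ![0, 0, -1] ?_ ?_ ?_) ⟨?_, ?_⟩⟩
  · ext i; fin_cases i <;> simp
  · ext i; fin_cases i <;> simp
  · ext i; fin_cases i <;> simp
  · rw [injective_iff_map_eq_zero]
    intro s hs
    have h0 : s.a + s.b * 0 + s.c * 0 = 0 := congrFun hs 0
    have h1 : s.a + s.b * -1 + s.c * 0 = 0 := congrFun hs 1
    have h2 : s.a + s.b * 0 + s.c * -1 = 0 := congrFun hs 2
    ext <;> simp only [zero_a, zero_b, zero_c]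
    · linear_combination h0
    · linear_combination h0 - h1
    · linear_combination h0 - h2
  · intro z
    refine ⟨⟨z 0, z 0 - z 1, z 0 - z 2⟩, ?_⟩
    ext i
    fin_cases i
    · change z 0 + (z 0 - z 1) * 0 + (z 0 - z 2) * 0 = z 0
      ring
    · change z 0 + (z 0 - z 1) * -1 + (z 0 - z 2) * 0 = z 1
      ring
    · change z 0 + (z 0 - z 1) * 0 + (z 0 - z 2) * -1 = z 2
      ring

variable (r : R)

/-- The inclusion `R + r S ⊆ S` of cubic rings on forms. -/
noncomputable def CubicRing.scaleHom (y : BinaryCubicForm R) :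
    CubicRing (⟨r * y.x₁, r * y.x₂, r * y.x₃, r * y.x₄⟩ : BinaryCubicForm R) →ₐ[R] CubicRing y :=
  CubicRing.lift _ ⟨0, r, 0⟩ ⟨0, 0, r⟩
    (by ext <;> simp <;> ring) (by ext <;> simp <;> ring) (by ext <;> simp <;> ring)

/-- The inclusion `R + R ω + R r θ ⊆ R + R ω + R θ` of cubic rings on forms. -/
noncomputable def CubicRing.partialScaleHom (a b c d : R) :
    CubicRing (⟨a, b, r * c, r * (r * d)⟩ : BinaryCubicForm R) →ₐ[R]
      CubicRing (⟨r * a, b, c, d⟩ : BinaryCubicForm R) :=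
  CubicRing.lift _ ⟨0, 1, 0⟩ ⟨0, 0, r⟩
    (by ext <;> simp <;> ring) (by ext <;> simp <;> ring) (by ext <;> simp <;> ring)

theorem CubicRing.scaleHom_apply (y : BinaryCubicForm R) (s) :
    scaleHom r y s = ⟨s.a, r * s.b, r * s.c⟩ := by
  rw [scaleHom, lift_apply]; ext <;> simp [mul_comm]

theorem CubicRing.partialScaleHom_apply (a b c d : R) (s) :
    partialScaleHom r a b c d s = ⟨s.a, s.b, r * s.c⟩ := by
  rw [partialScaleHom, lift_apply]; ext <;> simp [mul_comm]

end NormalForms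

end BinaryCubicForm

/-! ### Equivalence of forms, and roots over a field. -/

namespace BinaryCubicForm

section Action

variable {R S : Type*} [CommRing R] [CommRing S]

theorem evalDu_smul (g : GL (Fin 2) R) (x : BinaryCubicForm R) (u v : R) :
    (g • x).evalDu u v = ((Matrix.GeneralLinearGroup.det g)⁻¹ : Rˣ) *
      (g 0 0 * x.evalDu (g 0 0 * u + g 1 0 * v) (g 0 1 * u + g 1 1 * v) +
        g 0 1 * x.evalDv (g 0 0 * u + g 1 0 * v) (g 0 1 * u + g 1 1 * v)) := by
  simp only [evalDu, evalDv, HSMul.hSMul, SMul.smul]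
  ring

theorem evalDv_smul (g : GL (Fin 2) R) (x : BinaryCubicForm R) (u v : R) :
    (g • x).evalDv u v = ((Matrix.GeneralLinearGroup.det g)⁻¹ : Rˣ) *
      (g 1 0 * x.evalDu (g 0 0 * u + g 1 0 * v) (g 0 1 * u + g 1 1 * v) +
        g 1 1 * x.evalDv (g 0 0 * u + g 1 0 * v) (g 0 1 * u + g 1 1 * v)) := by
  simp only [evalDu, evalDv, HSMul.hSMul, SMul.smul]
  ring

theorem smul_zero_form (g : GL (Fin 2) R) :
    g • (⟨0, 0, 0, 0⟩ : BinaryCubicForm R) = ⟨0, 0, 0, 0⟩ := by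
  ext <;> simp [smul_x₁, smul_x₂, smul_x₃, smul_x₄, eval, evalDu, evalDv]

theorem map_smul (f : R →+* S) (g : GL (Fin 2) R) (x : BinaryCubicForm R) :
    (g • x).map f = Matrix.GeneralLinearGroup.map f g • x.map f := by
  refine eq_smul_of_matrix _ ?_ ?_ ?_ ?_ <;>
    simp only [map, smul_x₁, smul_x₂, smul_x₃, smul_x₄, eval, evalDu, evalDv,
      Matrix.GeneralLinearGroup.map_apply, map_mul, map_add, map_pow, map_ofNat] <;>
    have h := congrArg f (det_inv_mul g) <;>
    simp only [map_mul, map_sub, map_one] at h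
  · linear_combination (f x.x₁ * f (g 0 0) ^ 3 + f x.x₂ * f (g 0 0) ^ 2 * f (g 0 1)
      + f x.x₃ * f (g 0 0) * f (g 0 1) ^ 2 + f x.x₄ * f (g 0 1) ^ 3) * h
  · linear_combination ((3 * f x.x₁ * f (g 0 0) ^ 2 + 2 * f x.x₂ * f (g 0 0) * f (g 0 1)
      + f x.x₃ * f (g 0 1) ^ 2) * f (g 1 0) + (f x.x₂ * f (g 0 0) ^ 2
      + 2 * f x.x₃ * f (g 0 0) * f (g 0 1) + 3 * f x.x₄ * f (g 0 1) ^ 2) * f (g 1 1)) * h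
  · linear_combination ((3 * f x.x₁ * f (g 1 0) ^ 2 + 2 * f x.x₂ * f (g 1 0) * f (g 1 1)
      + f x.x₃ * f (g 1 1) ^ 2) * f (g 0 0) + (f x.x₂ * f (g 1 0) ^ 2
      + 2 * f x.x₃ * f (g 1 0) * f (g 1 1) + 3 * f x.x₄ * f (g 1 1) ^ 2) * f (g 0 1)) * h
  · linear_combination (f x.x₁ * f (g 1 0) ^ 3 + f x.x₂ * f (g 1 0) ^ 2 * f (g 1 1)
      + f x.x₃ * f (g 1 0) * f (g 1 1) ^ 2 + f x.x₄ * f (g 1 1) ^ 3) * h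

theorem map_map {T : Type*} [CommRing T] (f : R →+* S) (g : S →+* T) (x : BinaryCubicForm R) :
    (x.map f).map g = x.map (g.comp f) := rfl

theorem eval_map (f : R →+* S) (x : BinaryCubicForm R) (u v : R) :
    (x.map f).eval (f u) (f v) = f (x.eval u v) := by
  simp [map, eval]

theorem evalDu_map (f : R →+* S) (x : BinaryCubicForm R) (u v : R) :
    (x.map f).evalDu (f u) (f v) = f (x.evalDu u v) := by
  simp [map, evalDu, map_ofNat f]

theorem evalDv_map (f : R →+* S) (x : BinaryCubicForm R) (u v : R) :
    (x.map f).evalDv (f u) (f v) = f (x.evalDv u v) := by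
  simp [map, evalDv, map_ofNat f]

theorem exists_gl (α β γ δ : R) (h : IsUnit (α * δ - β * γ)) :
    ∃ g : GL (Fin 2) R, g 0 0 = α ∧ g 0 1 = β ∧ g 1 0 = γ ∧ g 1 1 = δ :=
  ⟨Matrix.GeneralLinearGroup.mk'' !![α, β; γ, δ] (by rwa [Matrix.det_fin_two_of]),
    rfl, rfl, rfl, rfl⟩

/-- Two forms are equivalent if they lie in the same `GL₂`-orbit. -/
def IsEquiv (x y : BinaryCubicForm R) : Prop := ∃ g : GL (Fin 2) R, g • x = y

theorem IsEquiv.refl (x : BinaryCubicForm R) : IsEquiv x x := ⟨1, one_smul _ _⟩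

theorem IsEquiv.symm {x y : BinaryCubicForm R} : IsEquiv x y → IsEquiv y x :=
  fun ⟨g, hg⟩ => ⟨g⁻¹, by rw [← hg, inv_smul_smul]⟩

theorem IsEquiv.trans {x y z : BinaryCubicForm R} : IsEquiv x y → IsEquiv y z → IsEquiv x z :=
  fun ⟨g, hg⟩ ⟨h, hh⟩ => ⟨h * g, by rw [mul_smul, hg, hh]⟩

theorem IsEquiv.correspondsTo_iff {x y : BinaryCubicForm R} (h : IsEquiv x y) {A : Type*}
    [CommRing A] [Algebra R A] : x.CorrespondsTo A ↔ y.CorrespondsTo A := by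
  obtain ⟨g, rfl⟩ := h
  exact (correspondsTo_smul_iff g x).symm

theorem CorrespondsTo.isEquiv {x y : BinaryCubicForm R} {A : Type*} [CommRing A] [Algebra R A]
    (hx : x.CorrespondsTo A) (hy : y.CorrespondsTo A) : IsEquiv x y := by
  obtain ⟨g, hg⟩ := hy.exists_eq_smul hx
  exact ⟨g, hg.symm⟩

theorem isEquiv_of_matrix {x y : BinaryCubicForm R} (α β γ δ : R) (h : IsUnit (α * δ - β * γ))
    (h₁ : y.x₁ * (α * δ - β * γ) = x.eval α β)
    (h₂ : y.x₂ * (α * δ - β * γ) = x.evalDu α β * γ + x.evalDv α β * δ)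
    (h₃ : y.x₃ * (α * δ - β * γ) = x.evalDu γ δ * α + x.evalDv γ δ * β)
    (h₄ : y.x₄ * (α * δ - β * γ) = x.eval γ δ) : IsEquiv x y := by
  obtain ⟨g, rfl, rfl, rfl, rfl⟩ := exists_gl α β γ δ h
  exact ⟨g, (eq_smul_of_matrix g h₁ h₂ h₃ h₄).symm⟩

theorem isEquiv_one_of_isUnit (a b c d : R) (h : IsUnit a) :
    IsEquiv (⟨a, b, c, d⟩ : BinaryCubicForm R) ⟨1, b, a * c, a ^ 2 * d⟩ :=
  isEquiv_of_matrix 1 0 0 a (by simpa using h) (by simp [eval]) (by simp [evalDv])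
    (by simp [evalDu]; ring) (by simp [eval]; ring)

theorem isEquiv_zero_one_of_isUnit (b c d : R) (h : IsUnit b) :
    IsEquiv (⟨0, b, c, d⟩ : BinaryCubicForm R) ⟨0, 1, c, b * d⟩ := by
  obtain ⟨b, rfl⟩ := h
  exact isEquiv_of_matrix (b⁻¹ : Rˣ) 0 0 1 (by simp) (by simp [eval])
    (by simp [evalDv, pow_two]) (by simp [evalDu])
    (by simp [eval, mul_right_comm _ d])

theorem isEquiv_zero_one_neg_one_of_isUnit (b : R) (h : IsUnit b) :
    IsEquiv (⟨0, 1, b, 0⟩ : BinaryCubicForm R) ⟨0, 1, -1, 0⟩ := by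
  obtain ⟨b, rfl⟩ := h
  exact isEquiv_of_matrix 1 0 0 (-(b⁻¹ : Rˣ) : R) (by simp) (by simp [eval])
    (by simp [evalDv]) (by simp [evalDu]; ring_nf; simp [pow_two]) (by simp [eval])

/-- The substitution `v ↦ tu + v`. It is applied with `(1, t)` a root, so that the first coefficient
becomes `0`. -/
theorem isEquiv_shift_left (x : BinaryCubicForm R) (t : R) :
    IsEquiv x ⟨x.eval 1 t, x.evalDv 1 t, x.x₃ + 3 * x.x₄ * t, x.x₄⟩ :=
  isEquiv_of_matrix 1 t 0 1 (by simp) (by simp) (by simp) (by simp [evalDu, evalDv])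
    (by simp [eval])

theorem isEquiv_shift_right_quadratic (b c t : R) :
    IsEquiv (⟨0, 1, b, c⟩ : BinaryCubicForm R) ⟨0, 1, b + 2 * t, t ^ 2 + b * t + c⟩ :=
  isEquiv_of_matrix 1 0 t 1 (by simp) (by simp [eval]) (by simp [evalDu, evalDv])
    (by simp [evalDu, evalDv]; ring) (by simp [eval])

end Action

section Field

variable {K : Type*} [Field K] (a : BinaryCubicForm K)

theorem eval_smul_smul (c u v : K) : a.eval (c * u) (c * v) = c ^ 3 * a.eval u v := by
  simp only [eval]; ring

theorem evalDu_smul_smul (c u v : K) : a.evalDu (c * u) (c * v) = c ^ 2 * a.evalDu u v := by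
  simp only [evalDu]; ring

theorem evalDv_smul_smul (c u v : K) : a.evalDv (c * u) (c * v) = c ^ 2 * a.evalDv u v := by
  simp only [evalDv]; ring

theorem mem_rootSet_mk (w : Fin 2 → K) (hw : w ≠ 0) :
    Projectivization.mk K w hw ∈ a.rootSet ↔ a.eval (w 0) (w 1) = 0 := by
  obtain ⟨c, hc⟩ := Projectivization.exists_smul_eq_mk_rep K w hw
  rw [rootSet, Set.mem_ofPred_eq, ← hc]
  simp [Units.smul_def, eval_smul_smul]

theorem isSimpleRoot_mk (w : Fin 2 → K) (hw : w ≠ 0) : a.IsSimpleRoot (Projectivization.mk K w hw) ↔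
    a.eval (w 0) (w 1) = 0 ∧ ¬ (a.evalDu (w 0) (w 1) = 0 ∧ a.evalDv (w 0) (w 1) = 0) := by
  obtain ⟨c, hc⟩ := Projectivization.exists_smul_eq_mk_rep K w hw
  rw [IsSimpleRoot, mem_rootSet_mk, ← hc]
  simp [Units.smul_def, evalDu_smul_smul, evalDv_smul_smul]

theorem vecMul_injective (g : GL (Fin 2) K) :
    Function.Injective (Matrix.vecMulLinear (R := K) g.val) := by
  rw [Matrix.coe_vecMulLinear]
  exact Matrix.vecMul_injective_of_isUnit g.isUnit

/-- The projective transformation attached to an element of `GL₂`. -/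
noncomputable def projMap (g : GL (Fin 2) K) :
    Projectivization K (Fin 2 → K) → Projectivization K (Fin 2 → K) :=
  Projectivization.map (Matrix.vecMulLinear g.val) (vecMul_injective g)

theorem projMap_mk (g : GL (Fin 2) K) (w : Fin 2 → K) (hw : w ≠ 0) :
    projMap g (Projectivization.mk K w hw) = Projectivization.mk K (Matrix.vecMul w g.val)
      (by simpa using (vecMul_injective g).ne hw) := rfl

theorem vecMul_zero (g : GL (Fin 2) K) (w : Fin 2 → K) :
    Matrix.vecMul w g.val 0 = g 0 0 * w 0 + g 1 0 * w 1 := by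
  simp [Matrix.vecMul, dotProduct, Fin.sum_univ_two, mul_comm]

theorem vecMul_one (g : GL (Fin 2) K) (w : Fin 2 → K) :
    Matrix.vecMul w g.val 1 = g 0 1 * w 0 + g 1 1 * w 1 := by
  simp [Matrix.vecMul, dotProduct, Fin.sum_univ_two, mul_comm]

theorem projMap_projMap_inv (g : GL (Fin 2) K) (P) : projMap g (projMap g⁻¹ P) = P := by
  induction P using Projectivization.ind with
  | h w hw =>
    simp only [projMap, Projectivization.map_mk]
    congr 1
    simp [-Matrix.coe_units_inv, Matrix.vecMul_vecMul]

theorem projMap_inv_projMap (g : GL (Fin 2) K) (P) : projMap g⁻¹ (projMap g P) = P := by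
  simpa using projMap_projMap_inv g⁻¹ P

variable {a}

/-- By the chain rule the gradient of `g • a` is, up to a unit, `g` applied to the gradient of `a`
at the transformed point. As `g` is invertible, both gradients vanish together. -/
theorem isSimpleRoot_smul_iff (g : GL (Fin 2) K) (P) :
    (g • a).IsSimpleRoot P ↔ a.IsSimpleRoot (projMap g P) := by
  induction P using Projectivization.ind with
  | h w hw =>
    simp only [projMap_mk, isSimpleRoot_mk, eval_smul, evalDu_smul, evalDv_smul, vecMul_zero,
      vecMul_one]
    have hd := det_inv_mul g
    simp only [mul_eq_zero, Units.ne_zero, false_or]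
    refine and_congr_right fun _ => not_congr ⟨fun ⟨h1, h2⟩ => ?_, fun ⟨h1, h2⟩ => ?_⟩
    · constructor
      · linear_combination (((Matrix.GeneralLinearGroup.det g)⁻¹ : Kˣ) : K) * (g 1 1 * h1 - g 0 1 * h2)
          - _ * hd
      · linear_combination (((Matrix.GeneralLinearGroup.det g)⁻¹ : Kˣ) : K) * (g 0 0 * h2 - g 1 0 * h1)
          - _ * hd
    · rw [h1, h2]; simp

theorem mem_rootSet_smul_iff (g : GL (Fin 2) K) (P) :
    P ∈ (g • a).rootSet ↔ projMap g P ∈ a.rootSet := by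
  induction P using Projectivization.ind with
  | h w hw =>
    rw [projMap_mk, mem_rootSet_mk, mem_rootSet_mk, eval_smul, vecMul_zero, vecMul_one,
      Units.mul_right_eq_zero]

theorem rootSet_smul (g : GL (Fin 2) K) : (g • a).rootSet = projMap g⁻¹ '' a.rootSet := by
  ext P
  rw [mem_rootSet_smul_iff]
  constructor
  · exact fun h => ⟨_, h, projMap_inv_projMap g P⟩
  · rintro ⟨Q, hQ, rfl⟩
    rwa [projMap_projMap_inv]

theorem projMap_injective (g : GL (Fin 2) K) : Function.Injective (projMap g) :=
  Function.LeftInverse.injective (projMap_inv_projMap g)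

/-- A nonzero form with two distinct roots has a simple root among them. -/
theorem isSimpleRoot_or_of_ne (ha : a ≠ ⟨0, 0, 0, 0⟩) {P Q} (hP : P ∈ a.rootSet)
    (hQ : Q ∈ a.rootSet) (hne : P ≠ Q) : a.IsSimpleRoot P ∨ a.IsSimpleRoot Q := by
  induction P using Projectivization.ind with
  | h w hw =>
  induction Q using Projectivization.ind with
  | h w' hw' =>
  by_contra! hcon
  rw [mem_rootSet_mk] at hP hQ
  simp only [isSimpleRoot_mk, hP, hQ, true_and, not_not] at hcon
  have hdet : w 0 * w' 1 - w 1 * w' 0 ≠ 0 := by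
    intro hdet
    apply hne
    rw [Projectivization.mk_eq_mk_iff']
    by_cases h0 : w' 0 = 0
    · have h1 : w' 1 ≠ 0 := fun h1 => hw' (by ext i; fin_cases i <;> simp [h0, h1])
      refine ⟨w 1 / w' 1, ?_⟩
      ext i; fin_cases i
      · simp [h0, h1] at hdet ⊢
        exact hdet.symm
      · simp [h1]
    · refine ⟨w 0 / w' 0, ?_⟩
      ext i; fin_cases i
      · simp [h0]
      · simp
        field_simp
        linear_combination hdet
  -- Move the two roots to `(1 : 0)` and `(0 : 1)`. A multiple root at the first kills `x₁` and
  -- `x₂`, at the second `x₃` and `x₄`.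
  obtain ⟨g, h00, h01, h10, h11⟩ := exists_gl (w 0) (w 1) (w' 0) (w' 1) (isUnit_iff_ne_zero.2 hdet)
  apply ha
  rw [← smul_zero_form g⁻¹, eq_inv_smul_iff]
  ext <;> simp [smul_x₁, smul_x₂, smul_x₃, smul_x₄, h00, h01, h10, h11, hP, hQ, hcon]

end Field

end BinaryCubicForm

/-! ### Reduction of `ℤ_p` modulo `p` and `p²`. -/

section Residue

variable (p : ℕ) [Fact p.Prime]

/-- The residue map `ℤ_p → 𝔽_p`. -/
noncomputable def residueMap : ℤ_[p] →+* ZMod p :=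
  (reduceModP p).comp (PadicInt.toZModPow 2)

theorem residueMap_surjective : Function.Surjective (residueMap p) :=
  ZMod.ringHom_surjective _

variable {p}

theorem residueMap_eq_zero_iff {z : ℤ_[p]} : residueMap p z = 0 ↔ (p : ℤ_[p]) ∣ z := by
  rw [← RingHom.mem_ker, IsLocalRing.ker_eq_maximalIdeal _ (residueMap_surjective p),
    PadicInt.maximalIdeal_eq_span_p, Ideal.mem_span_singleton]

theorem PadicInt.isUnit_iff_not_dvd {z : ℤ_[p]} : IsUnit z ↔ ¬ (p : ℤ_[p]) ∣ z := by
  rw [← PadicInt.norm_lt_one_iff_dvd, ← PadicInt.not_isUnit_iff, not_not]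

theorem isUnit_toZModPow_two_iff {z : ℤ_[p]} :
    IsUnit (PadicInt.toZModPow 2 z) ↔ ¬ (p : ℤ_[p]) ∣ z := by
  refine ⟨fun h hz => ?_, fun h => (PadicInt.isUnit_iff_not_dvd.2 h).map _⟩
  have := h.map (reduceModP p)
  rw [← RingHom.comp_apply] at this
  exact this.ne_zero (residueMap_eq_zero_iff.2 hz)

theorem toZModPow_two_eq_zero_iff {z : ℤ_[p]} :
    PadicInt.toZModPow 2 z = 0 ↔ (p : ℤ_[p]) ^ 2 ∣ z := by
  rw [← RingHom.mem_ker, PadicInt.ker_toZModPow, Ideal.mem_span_singleton]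

theorem dvd_toZModPow_two_iff {z : ℤ_[p]} :
    (p : ZMod (p ^ 2)) ∣ PadicInt.toZModPow 2 z ↔ (p : ℤ_[p]) ∣ z := by
  constructor
  · rintro ⟨w, hw⟩
    obtain ⟨w, rfl⟩ := ZMod.ringHom_surjective (PadicInt.toZModPow 2 : ℤ_[p] →+* _) w
    rw [← map_natCast (PadicInt.toZModPow 2 : ℤ_[p] →+* _), ← map_mul, ← sub_eq_zero, ← map_sub,
      toZModPow_two_eq_zero_iff] at hw
    have := (dvd_pow_self (p : ℤ_[p]) two_ne_zero).trans hw
    exact (dvd_sub_left (dvd_mul_right _ _)).1 this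
  · intro h
    simpa using map_dvd (PadicInt.toZModPow 2 : ℤ_[p] →+* _) h

theorem exists_isUnit_toZModPow_two_iff {z : ℤ_[p]} :
    (∃ w, IsUnit w ∧ PadicInt.toZModPow 2 z = (p : ZMod (p ^ 2)) * w) ↔
      (p : ℤ_[p]) ∣ z ∧ ¬ (p : ℤ_[p]) ^ 2 ∣ z := by
  constructor
  · rintro ⟨w, hw, h⟩
    refine ⟨dvd_toZModPow_two_iff.1 ⟨w, h⟩, fun h2 => ?_⟩
    obtain ⟨w, rfl⟩ := ZMod.ringHom_surjective (PadicInt.toZModPow 2 : ℤ_[p] →+* _) w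
    rw [toZModPow_two_eq_zero_iff.2 h2, ← map_natCast (PadicInt.toZModPow 2 : ℤ_[p] →+* _),
      ← map_mul, eq_comm, toZModPow_two_eq_zero_iff, pow_two,
      mul_dvd_mul_iff_left PadicInt.prime_p.ne_zero] at h
    exact isUnit_toZModPow_two_iff.1 hw h
  · rintro ⟨⟨w, rfl⟩, h⟩
    refine ⟨PadicInt.toZModPow 2 w, isUnit_toZModPow_two_iff.2 fun hw => h ?_, by simp⟩
    rw [pow_two]
    exact mul_dvd_mul_left _ hw

/-- Entries can be lifted arbitrarily: the determinant of the lift is a unit modulo `p²`, hence a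
unit of the local ring `ℤ_p`. -/
theorem exists_map_toZModPow_two (g : GL (Fin 2) (ZMod (p ^ 2))) :
    ∃ h : GL (Fin 2) ℤ_[p], Matrix.GeneralLinearGroup.map (PadicInt.toZModPow 2) h = g := by
  have hs := ZMod.ringHom_surjective (PadicInt.toZModPow 2 : ℤ_[p] →+* ZMod (p ^ 2))
  obtain ⟨α, hα⟩ := hs (g 0 0)
  obtain ⟨β, hβ⟩ := hs (g 0 1)
  obtain ⟨γ, hγ⟩ := hs (g 1 0)
  obtain ⟨δ, hδ⟩ := hs (g 1 1)
  obtain ⟨h, h00, h01, h10, h11⟩ := BinaryCubicForm.exists_gl α β γ δ (by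
    rw [PadicInt.isUnit_iff_not_dvd, ← isUnit_toZModPow_two_iff, map_sub, map_mul, map_mul, hα,
      hβ, hγ, hδ]
    exact .of_mul_eq_one_right _ (BinaryCubicForm.det_inv_mul g))
  refine ⟨h, Units.ext (Matrix.ext fun i j => ?_)⟩
  change PadicInt.toZModPow 2 (h i j) = g i j
  fin_cases i <;> fin_cases j <;> simp [h00, h01, h10, h11, hα, hβ, hγ, hδ]

open Polynomial in
/-- Hensel's lemma for a polynomial of degree at most three. -/
theorem PadicInt.exists_root_of_dvd (e₀ e₁ e₂ e₃ t : ℤ_[p])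
    (h : (p : ℤ_[p]) ∣ e₀ + e₁ * t + e₂ * t ^ 2 + e₃ * t ^ 3)
    (h' : ¬ (p : ℤ_[p]) ∣ e₁ + 2 * e₂ * t + 3 * e₃ * t ^ 2) :
    ∃ s, e₀ + e₁ * s + e₂ * s ^ 2 + e₃ * s ^ 3 = 0 ∧ (p : ℤ_[p]) ∣ s - t := by
  let F : ℤ_[p][X] := C e₀ + C e₁ * X + C e₂ * X ^ 2 + C e₃ * X ^ 3
  have hF (s) : aeval s F = e₀ + e₁ * s + e₂ * s ^ 2 + e₃ * s ^ 3 := by simp [F]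
  have hF' (s) : aeval s F.derivative = e₁ + 2 * e₂ * s + 3 * e₃ * s ^ 2 := by
    simp [F, map_ofNat]; ring
  have hn : ‖aeval t F.derivative‖ = 1 := by
    rw [← PadicInt.isUnit_iff, PadicInt.isUnit_iff_not_dvd, hF']
    exact h'
  obtain ⟨s, hs, hst, -⟩ := hensels_lemma (F := F) (a := t) (by
    rw [hn, one_pow, PadicInt.norm_lt_one_iff_dvd, hF]
    exact h)
  rw [hn, PadicInt.norm_lt_one_iff_dvd] at hst
  exact ⟨s, by rw [← hF, hs], hst⟩

end Residue

/-! ### The five types over `ℤ_p`: normal forms and the dichotomy with reducible forms. -/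

namespace BinaryCubicForm

variable {p : ℕ} [Fact p.Prime]

theorem mem_padicForms_of_isEquiv {σ : MaximalType} {x y : BinaryCubicForm ℤ_[p]}
    (h : IsEquiv x y) (hx : x ∈ padicForms p σ) : y ∈ padicForms p σ := by
  obtain ⟨g, rfl⟩ := h
  have key : ((g • x).map (PadicInt.toZModPow 2)).map (reduceModP p) =
      Matrix.GeneralLinearGroup.map (residueMap p) g • (x.map (PadicInt.toZModPow 2)).map
        (reduceModP p) := by
    rw [map_map, map_map]
    exact map_smul (residueMap p) g x
  change (g • x).map _ ∈ formsModPSq p σ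
  change x.map _ ∈ formsModPSq p σ at hx
  cases σ
  · change _ ∈ formsModP3 p
    rw [key, formsModP3, Set.mem_ofPred_eq, rootSet_smul,
      show rootSet (map (reduceModP p) (map (PadicInt.toZModPow 2) x)) = ∅ from hx, Set.image_empty]
  · obtain ⟨P, hP, hs⟩ := hx
    change _ ∈ formsModP21 p
    rw [key]
    refine ⟨projMap (Matrix.GeneralLinearGroup.map (residueMap p) g)⁻¹ P, ?_, ?_⟩
    · rw [rootSet_smul, hP, Set.image_singleton]
    · rwa [isSimpleRoot_smul_iff, projMap_projMap_inv]
  · obtain ⟨h0, h3⟩ := hx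
    change _ ∈ formsModP111 p
    rw [key]
    refine ⟨fun h => h0 ?_, ?_⟩
    · rw [← eq_inv_smul_iff, smul_zero_form] at h
      exact h
    · rw [rootSet_smul, Set.ncard_image_of_injective _ (projMap_injective _), h3]
  all_goals
    obtain ⟨h, b, hb, hx⟩ := hx
    exact ⟨Matrix.GeneralLinearGroup.map (PadicInt.toZModPow 2) g * h, b, hb, by
      rw [map_smul, hx, mul_smul]⟩

theorem mem_padicForms_iff_of_isEquiv {σ : MaximalType} {x y : BinaryCubicForm ℤ_[p]}
    (h : IsEquiv x y) : x ∈ padicForms p σ ↔ y ∈ padicForms p σ :=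
  ⟨mem_padicForms_of_isEquiv h, mem_padicForms_of_isEquiv h.symm⟩

theorem exists_gl_first_row (r s : ℤ_[p])
    (h : ¬ ((p : ℤ_[p]) ∣ r ∧ (p : ℤ_[p]) ∣ s)) :
    ∃ g : GL (Fin 2) ℤ_[p], g 0 0 = r ∧ g 0 1 = s := by
  by_cases hr : (p : ℤ_[p]) ∣ r
  · obtain ⟨g, h1, h2, -⟩ := exists_gl r s 1 0 (by
      simpa [PadicInt.isUnit_iff_not_dvd] using fun hs => h ⟨hr, hs⟩)
    exact ⟨g, h1, h2⟩
  · obtain ⟨g, h1, h2, -⟩ := exists_gl r s 0 1 (by simpa [PadicInt.isUnit_iff_not_dvd] using hr)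
    exact ⟨g, h1, h2⟩

/-- A form with vanishing first and unit second coefficient modulo `p` is equivalent to one with
coefficients `0, 1`. -/
theorem exists_isEquiv_zero_one (a b c d : ℤ_[p]) (ha : (p : ℤ_[p]) ∣ a) (hb : ¬ (p : ℤ_[p]) ∣ b) :
    ∃ t b', (p : ℤ_[p]) ∣ t ∧ ¬ (p : ℤ_[p]) ∣ b' ∧
      IsEquiv (⟨a, b, c, d⟩ : BinaryCubicForm ℤ_[p]) ⟨0, 1, c + 3 * d * t, b' * d⟩ := by
  obtain ⟨t, ht, hpt⟩ := PadicInt.exists_root_of_dvd a b c d 0 (by simpa using ha)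
    (by simpa using hb)
  rw [sub_zero] at hpt
  have h := isEquiv_shift_left (⟨a, b, c, d⟩ : BinaryCubicForm ℤ_[p]) t
  rw [show eval _ 1 t = 0 by rw [← ht]; simp [eval]] at h
  have hb' : ¬ (p : ℤ_[p]) ∣ evalDv (⟨a, b, c, d⟩ : BinaryCubicForm ℤ_[p]) 1 t := by
    intro h'
    apply hb
    obtain ⟨t, rfl⟩ := hpt
    simp only [evalDv] at h'
    rw [show b * 1 ^ 2 + 2 * c * 1 * (p * t) + 3 * d * (p * t) ^ 2
      = b + p * (2 * c * t + 3 * d * p * t ^ 2) by ring] at h'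
    exact (dvd_add_left (dvd_mul_right _ _)).1 h'
  exact ⟨t, _, hpt, hb', h.trans (isEquiv_zero_one_of_isUnit _ _ _ (PadicInt.isUnit_iff_not_dvd.2 hb'))⟩

/-- Complete a lift of the root to a matrix in `GL₂(ℤ_p)`. In the new coordinates `p` divides the
first coefficient but, by simplicity, not the second, and Hensel's lemma makes the first coefficient
exactly `0`. -/
theorem exists_isEquiv_of_isSimpleRoot (x : BinaryCubicForm ℤ_[p]) {P}
    (hP : (x.map (residueMap p)).IsSimpleRoot P) : ∃ b c, IsEquiv x ⟨0, 1, b, c⟩ := by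
  induction P using Projectivization.ind with
  | h w hw =>
  rw [isSimpleRoot_mk] at hP
  obtain ⟨r, hr⟩ := residueMap_surjective p (w 0)
  obtain ⟨s, hs⟩ := residueMap_surjective p (w 1)
  rw [← hr, ← hs, eval_map, evalDu_map, evalDv_map, residueMap_eq_zero_iff, residueMap_eq_zero_iff,
    residueMap_eq_zero_iff] at hP
  obtain ⟨g, rfl, rfl⟩ := exists_gl_first_row r s (by
    rw [← residueMap_eq_zero_iff, ← residueMap_eq_zero_iff, hr, hs]
    rintro ⟨h0, h1⟩
    exact hw (by ext i; fin_cases i <;> simp [h0, h1]))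
  obtain ⟨h0, h1⟩ := hP
  have hd := det_inv_mul g
  obtain ⟨d, hdd⟩ : ∃ d : ℤ_[p], d = ((Matrix.GeneralLinearGroup.det g)⁻¹ : ℤ_[p]ˣ) := ⟨_, rfl⟩
  rw [← hdd] at hd
  have h2 : ¬ (p : ℤ_[p]) ∣ (g • x).x₂ := by
    intro h2
    apply h1
    -- Euler's relation: the gradient pairs to `0` modulo `p` with the first row of `g`. If `p`
    -- divided `x₂`, it would do so with the second row as well, hence vanish.
    have e : g 0 0 * x.evalDu (g 0 0) (g 0 1) + g 0 1 * x.evalDv (g 0 0) (g 0 1) =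
      3 * x.eval (g 0 0) (g 0 1) := by simp only [eval, evalDu, evalDv]; ring
    have e2 := smul_x₂ g x
    rw [← hdd] at e2
    obtain ⟨m, hm⟩ := h2
    obtain ⟨n, hn⟩ := h0
    rw [hm] at e2
    rw [hn] at e
    constructor
    · exact ⟨d * (g 1 1 * 3 * n) - g 0 1 * m, by
        linear_combination g 1 1 * d * e + g 0 1 * e2 - x.evalDu (g 0 0) (g 0 1) * hd⟩
    · exact ⟨g 0 0 * m - d * (g 1 0 * 3 * n), by
        linear_combination -g 1 0 * d * e - g 0 0 * e2 - x.evalDv (g 0 0) (g 0 1) * hd⟩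
  obtain ⟨t, b', -, -, h⟩ := exists_isEquiv_zero_one (g • x).x₁ (g • x).x₂ (g • x).x₃ (g • x).x₄
    (by rw [smul_x₁]; exact dvd_mul_of_dvd_right h0 _) h2
  exact ⟨_, _, IsEquiv.trans ⟨g, rfl⟩ h⟩

theorem vec_ne_zero_of_one {K : Type*} [Field K] (t : K) : ![t, 1] ≠ 0 :=
  fun h => one_ne_zero (congrFun h 1)

theorem vec_one_zero_ne_zero {K : Type*} [Field K] : ![(1 : K), 0] ≠ 0 :=
  fun h => one_ne_zero (congrFun h 0)

/-- The points of the projective line. -/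
theorem eq_mk_of_projectivization {K : Type*} [Field K] (P : Projectivization K (Fin 2 → K)) :
    P = Projectivization.mk K ![1, 0] vec_one_zero_ne_zero ∨
      ∃ t, P = Projectivization.mk K ![t, 1] (vec_ne_zero_of_one t) := by
  induction P using Projectivization.ind with
  | h w hw =>
  by_cases h : w 1 = 0
  · left
    rw [Projectivization.mk_eq_mk_iff']
    refine ⟨w 0, ?_⟩
    ext i; fin_cases i <;> simp [h]
  · right
    refine ⟨w 0 / w 1, ?_⟩
    rw [Projectivization.mk_eq_mk_iff']
    refine ⟨w 1, ?_⟩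
    ext i; fin_cases i <;> simp
    field_simp

theorem mk_ne_mk {K : Type*} [Field K] (t : K) :
    Projectivization.mk K ![1, 0] vec_one_zero_ne_zero ≠
      Projectivization.mk K ![t, 1] (vec_ne_zero_of_one t) := by
  rw [Ne, Projectivization.mk_eq_mk_iff']
  rintro ⟨c, hc⟩
  have h0 := congrFun hc 0
  have h1 := congrFun hc 1
  simp at h0 h1
  simp [h1] at h0

theorem mk_eq_mk_iff_eq {K : Type*} [Field K] (s t : K) :
    Projectivization.mk K ![s, 1] (vec_ne_zero_of_one s) =
      Projectivization.mk K ![t, 1] (vec_ne_zero_of_one t) ↔ s = t := by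
  refine ⟨fun h => ?_, fun h => by subst h; rfl⟩
  rw [Projectivization.mk_eq_mk_iff'] at h
  obtain ⟨c, hc⟩ := h
  have h0 := congrFun hc 0
  have h1 := congrFun hc 1
  simp at h0 h1
  simp [h1] at h0
  exact h0.symm

/-- Since `(1 : 0)` is not a root modulo `p`, the leading coefficient is a unit and can be
normalised to `1`; the other points of the line are the `(t : 1)`. -/
theorem mem_padicForms_t3_iff {x : BinaryCubicForm ℤ_[p]} : x ∈ padicForms p .t3 ↔
    ∃ b c d, IsEquiv x ⟨1, b, c, d⟩ ∧ ∀ t, ¬ (p : ℤ_[p]) ∣ t ^ 3 + b * t ^ 2 + c * t + d := by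
  constructor
  · intro hx
    have h1 : ¬ (p : ℤ_[p]) ∣ x.x₁ := by
      intro h
      have : Projectivization.mk (ZMod p) ![1, 0] vec_one_zero_ne_zero ∉
        (x.map (residueMap p)).rootSet := by
          rw [show (x.map (residueMap p)).rootSet = ∅ from hx]; simp
      rw [mem_rootSet_mk] at this
      simp [eval, map, residueMap_eq_zero_iff, h] at this
    have he := isEquiv_one_of_isUnit _ x.x₂ x.x₃ x.x₄ (PadicInt.isUnit_iff_not_dvd.2 h1)
    refine ⟨_, _, _, he, fun t ht => ?_⟩
    have hy := mem_padicForms_of_isEquiv (x := x) he hx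
    have : Projectivization.mk (ZMod p) ![residueMap p t, 1] (vec_ne_zero_of_one _) ∈
        ((⟨1, x.x₂, x.x₁ * x.x₃, x.x₁ ^ 2 * x.x₄⟩ : BinaryCubicForm ℤ_[p]).map
          (residueMap p)).rootSet := by
      rw [mem_rootSet_mk]
      have := eval_map (residueMap p) (⟨1, x.x₂, x.x₁ * x.x₃, x.x₁ ^ 2 * x.x₄⟩ :
        BinaryCubicForm ℤ_[p]) t 1
      rw [map_one] at this
      refine this.trans (residueMap_eq_zero_iff.2 ?_)
      simpa [eval] using ht
    exact (Set.mem_empty_iff_false _).1 ((show rootSet _ = ∅ from hy) ▸ this)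
  · rintro ⟨b, c, d, hx, h⟩
    rw [mem_padicForms_iff_of_isEquiv hx]
    change rootSet (map (residueMap p) _) = ∅
    ext P
    simp only [Set.mem_empty_iff_false, iff_false]
    rcases eq_mk_of_projectivization P with rfl | ⟨t, rfl⟩
    · simp [mem_rootSet_mk, eval, map]
    · obtain ⟨t, rfl⟩ := residueMap_surjective p t
      rw [mem_rootSet_mk]
      have := eval_map (residueMap p) (⟨1, b, c, d⟩ : BinaryCubicForm ℤ_[p]) t 1
      rw [map_one] at this
      simp only [Matrix.cons_val_zero, Matrix.cons_val_one]
      rw [this, residueMap_eq_zero_iff]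
      simpa [eval] using h t

theorem mk_mem_rootSet_quadratic_iff {K : Type*} [Field K] (b c t : K) :
    Projectivization.mk K ![t, 1] (vec_ne_zero_of_one t) ∈
      (⟨0, 1, b, c⟩ : BinaryCubicForm K).rootSet ↔ t ^ 2 + b * t + c = 0 := by
  simp [mem_rootSet_mk, eval]

theorem mk_one_zero_mem_rootSet_quadratic {K : Type*} [Field K] (b c : K) :
    Projectivization.mk K ![1, 0] vec_one_zero_ne_zero ∈
      (⟨0, 1, b, c⟩ : BinaryCubicForm K).rootSet := by
  simp [mem_rootSet_mk, eval]

theorem map_residueMap_quadratic (b c : ℤ_[p]) :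
    (⟨0, 1, b, c⟩ : BinaryCubicForm ℤ_[p]).map (residueMap p) =
      ⟨0, 1, residueMap p b, residueMap p c⟩ := by
  simp [map]

/-- The simple root is moved to `(1 : 0)`. It is the only root exactly when the remaining quadratic
factor has none modulo `p`. -/
theorem mem_padicForms_t21_iff {x : BinaryCubicForm ℤ_[p]} : x ∈ padicForms p .t21 ↔
    ∃ b c, IsEquiv x ⟨0, 1, b, c⟩ ∧ ∀ t, ¬ (p : ℤ_[p]) ∣ t ^ 2 + b * t + c := by
  constructor
  · intro hx
    obtain ⟨P, -, hP⟩ := id hx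
    obtain ⟨b, c, h⟩ := exists_isEquiv_of_isSimpleRoot x hP
    refine ⟨b, c, h, fun t ht => ?_⟩
    have hy := mem_padicForms_of_isEquiv (σ := .t21) h hx
    obtain ⟨Q, hQ, -⟩ := hy
    rw [map_map] at hQ
    change rootSet (map (residueMap p) _) = _ at hQ
    rw [map_residueMap_quadratic] at hQ
    have h1 := mk_one_zero_mem_rootSet_quadratic (residueMap p b) (residueMap p c)
    have h2 := (mk_mem_rootSet_quadratic_iff (residueMap p b) (residueMap p c) (residueMap p t)).2
      (by rwa [← map_pow, ← map_mul, ← map_add, ← map_add, residueMap_eq_zero_iff])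
    rw [hQ, Set.mem_singleton_iff] at h1 h2
    exact mk_ne_mk _ (h1.trans h2.symm)
  · rintro ⟨b, c, hx, h⟩
    rw [mem_padicForms_iff_of_isEquiv hx]
    change map (residueMap p) _ ∈ formsModP21 p
    rw [map_residueMap_quadratic]
    refine ⟨Projectivization.mk (ZMod p) ![1, 0] vec_one_zero_ne_zero, ?_, ?_⟩
    · ext P
      rw [Set.mem_singleton_iff]
      refine ⟨fun hP => ?_, fun hP => hP ▸ mk_one_zero_mem_rootSet_quadratic _ _⟩
      rcases eq_mk_of_projectivization P with rfl | ⟨t, rfl⟩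
      · rfl
      · obtain ⟨t, rfl⟩ := residueMap_surjective p t
        rw [mk_mem_rootSet_quadratic_iff, ← map_pow, ← map_mul, ← map_add, ← map_add,
          residueMap_eq_zero_iff] at hP
        exact (h t hP).elim
    · simp [isSimpleRoot_mk, eval, evalDu, evalDv]

/-- A form `(0, 1, b, c)` whose quadratic factor has a simple root modulo `p`. -/
theorem isEquiv_split_of_dvd {b c t : ℤ_[p]} (h : (p : ℤ_[p]) ∣ t ^ 2 + b * t + c)
    (h' : ¬ (p : ℤ_[p]) ∣ b + 2 * t) :
    IsEquiv (⟨0, 1, b, c⟩ : BinaryCubicForm ℤ_[p]) ⟨0, 1, -1, 0⟩ := by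
  obtain ⟨s, hs, hst⟩ := PadicInt.exists_root_of_dvd c b 1 0 t (by convert h using 1; ring)
    (by convert h' using 2; ring)
  have h1 := isEquiv_shift_right_quadratic b c s
  rw [show s ^ 2 + b * s + c = 0 by rw [← hs]; ring] at h1
  refine h1.trans (isEquiv_zero_one_neg_one_of_isUnit _ (PadicInt.isUnit_iff_not_dvd.2 fun h2 => h' ?_))
  have := dvd_sub h2 (dvd_mul_of_dvd_right hst 2)
  convert this using 1
  ring

theorem mem_padicForms_t111_iff {x : BinaryCubicForm ℤ_[p]} :
    x ∈ padicForms p .t111 ↔ IsEquiv x ⟨0, 1, -1, 0⟩ := by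
  constructor
  · intro hx
    obtain ⟨P, hP⟩ : ∃ P, (x.map (residueMap p)).IsSimpleRoot P := by
      -- Nonvanishing matters for `p = 2`, where the zero form also has exactly three roots.
      obtain ⟨h0, h3⟩ := hx
      obtain ⟨P, Q, T, hPQ, -, -, h⟩ := Set.ncard_eq_three.1 h3
      rcases isSimpleRoot_or_of_ne h0 (P := P) (Q := Q) (by simp [h]) (by simp [h]) hPQ with h | h
      exacts [⟨_, h⟩, ⟨_, h⟩]
    obtain ⟨b, c, h⟩ := exists_isEquiv_of_isSimpleRoot x hP
    refine h.trans ?_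
    obtain ⟨-, h3⟩ := mem_padicForms_of_isEquiv (σ := .t111) h hx
    change (rootSet (map (residueMap p) _)).ncard = 3 at h3
    rw [map_residueMap_quadratic] at h3
    set S := rootSet (⟨0, 1, residueMap p b, residueMap p c⟩ : BinaryCubicForm (ZMod p)) with hS
    set O := Projectivization.mk (ZMod p) ![(1 : ZMod p), 0] vec_one_zero_ne_zero with hO
    obtain ⟨P, Q, hPQ, hPQS⟩ : ∃ P Q, P ≠ Q ∧ S \ {O} = {P, Q} := by
      rw [← Set.ncard_eq_two, Set.ncard_sdiff_singleton_of_mem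
        (mk_one_zero_mem_rootSet_quadratic _ _), h3]
    have hmem (T) (hT : T ∈ S \ {O}) : ∃ t : ℤ_[p], T = Projectivization.mk (ZMod p)
        ![residueMap p t, 1] (vec_ne_zero_of_one _) ∧ (p : ℤ_[p]) ∣ t ^ 2 + b * t + c := by
      rcases eq_mk_of_projectivization T with hTO | ⟨t, rfl⟩
      · exact (hT.2 hTO).elim
      · obtain ⟨t, rfl⟩ := residueMap_surjective p t
        refine ⟨t, rfl, ?_⟩
        have := hT.1
        rwa [hS, mk_mem_rootSet_quadratic_iff, ← map_pow, ← map_mul, ← map_add, ← map_add,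
          residueMap_eq_zero_iff] at this
    obtain ⟨t, rfl, ht⟩ := hmem P (by simp [hPQS])
    obtain ⟨s, rfl, hs⟩ := hmem Q (by simp [hPQS])
    rw [Ne, mk_eq_mk_iff_eq, ← sub_eq_zero, ← map_sub, residueMap_eq_zero_iff] at hPQ
    -- Modulo `p` the two roots satisfy `t + s = -b`, so `b + 2t = t - s` is nonzero and `t` is a
    -- simple root.
    refine isEquiv_split_of_dvd ht fun h2 => ?_
    have h4 : (p : ℤ_[p]) ∣ (t - s) * (t + s + b) := by
      convert dvd_sub ht hs using 1; ring
    have h5 := (PadicInt.prime_p.dvd_or_dvd h4).resolve_left hPQ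
    apply hPQ
    convert dvd_sub h2 h5 using 1
    ring
  · intro hx
    rw [mem_padicForms_iff_of_isEquiv hx]
    change map (residueMap p) _ ∈ formsModP111 p
    rw [map_residueMap_quadratic]
    refine ⟨by simp, Set.ncard_eq_three.2 ⟨Projectivization.mk (ZMod p) ![(1 : ZMod p), 0]
      vec_one_zero_ne_zero, Projectivization.mk (ZMod p) ![(0 : ZMod p), 1] (vec_ne_zero_of_one _),
      Projectivization.mk (ZMod p) ![(1 : ZMod p), 1] (vec_ne_zero_of_one _), mk_ne_mk _, mk_ne_mk _, ?_, ?_⟩⟩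
    · rw [Ne, mk_eq_mk_iff_eq]; exact zero_ne_one
    · ext P
      simp only [Set.mem_insert_iff, Set.mem_singleton_iff]
      rcases eq_mk_of_projectivization P with rfl | ⟨t, rfl⟩
      · simp only [true_or, iff_true]
        exact mk_one_zero_mem_rootSet_quadratic _ _
      · rw [mk_mem_rootSet_quadratic_iff, mk_eq_mk_iff_eq, mk_eq_mk_iff_eq]
        simp only [(mk_ne_mk t).symm, false_or]
        rw [show t ^ 2 + residueMap p (-1) * t + residueMap p 0 = t * (t - 1) by simp; ring,
          mul_eq_zero, sub_eq_zero]

theorem mem_padicForms_t13max_iff {x : BinaryCubicForm ℤ_[p]} : x ∈ padicForms p .t13max ↔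
    ∃ b c d, IsEquiv x ⟨1, b, c, d⟩ ∧ (p : ℤ_[p]) ∣ b ∧ (p : ℤ_[p]) ∣ c ∧ (p : ℤ_[p]) ∣ d ∧
      ¬ (p : ℤ_[p]) ^ 2 ∣ d := by
  constructor
  · rintro ⟨g, e, ⟨h1, h2, h3, h4⟩, hx⟩
    obtain ⟨g, rfl⟩ := exists_map_toZModPow_two g
    obtain rfl : (g⁻¹ • x).map (PadicInt.toZModPow 2) = e := by
      rw [map_smul, hx, Matrix.GeneralLinearGroup.map_inv, inv_smul_smul]
    set y := g⁻¹ • x with hy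
    simp only [map] at h1 h2 h3 h4
    rw [isUnit_toZModPow_two_iff] at h1
    rw [dvd_toZModPow_two_iff] at h2 h3
    obtain ⟨h4, h5⟩ := exists_isUnit_toZModPow_two_iff.1 h4
    have hu := PadicInt.isUnit_iff_not_dvd.2 h1
    refine ⟨_, _, _, IsEquiv.trans ⟨g⁻¹, rfl⟩ (isEquiv_one_of_isUnit y.x₁ y.x₂ y.x₃ y.x₄ hu), h2,
      dvd_mul_of_dvd_right h3 _, dvd_mul_of_dvd_right h4 _, ?_⟩
    rwa [(hu.pow 2).dvd_mul_left]
  · rintro ⟨b, c, d, hx, hb, hc, hd, hd'⟩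
    rw [mem_padicForms_iff_of_isEquiv hx]
    refine ⟨1, _, ⟨?_, ?_, ?_, ?_⟩, (one_smul _ _).symm⟩
    · simp [map]
    · exact dvd_toZModPow_two_iff.2 hb
    · exact dvd_toZModPow_two_iff.2 hc
    · exact exists_isUnit_toZModPow_two_iff.2 ⟨hd, hd'⟩

theorem mem_padicForms_t121max_iff {x : BinaryCubicForm ℤ_[p]} : x ∈ padicForms p .t121max ↔
    ∃ b c, IsEquiv x ⟨0, 1, b, c⟩ ∧ (p : ℤ_[p]) ∣ b ∧ (p : ℤ_[p]) ∣ c ∧ ¬ (p : ℤ_[p]) ^ 2 ∣ c := by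
  constructor
  · rintro ⟨g, e, ⟨h1, h2, h3, h4⟩, hx⟩
    obtain ⟨g, rfl⟩ := exists_map_toZModPow_two g
    obtain rfl : (g⁻¹ • x).map (PadicInt.toZModPow 2) = e := by
      rw [map_smul, hx, Matrix.GeneralLinearGroup.map_inv, inv_smul_smul]
    set y := g⁻¹ • x with hy
    simp only [map] at h1 h2 h3 h4
    rw [isUnit_toZModPow_two_iff] at h2
    rw [toZModPow_two_eq_zero_iff] at h1
    rw [dvd_toZModPow_two_iff] at h3
    obtain ⟨h4, h5⟩ := exists_isUnit_toZModPow_two_iff.1 h4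
    -- The lift of the coefficient `0` is only divisible by `p²`. Making it exactly `0` uses a shift
    -- by a multiple of `p`, which preserves the divisibility conditions.
    obtain ⟨t, b', ht, hb', h⟩ := exists_isEquiv_zero_one y.x₁ y.x₂ y.x₃ y.x₄
      ((dvd_pow_self _ two_ne_zero).trans h1) h2
    refine ⟨_, _, IsEquiv.trans ⟨g⁻¹, rfl⟩ h, dvd_add h3 (dvd_mul_of_dvd_right ht _),
      dvd_mul_of_dvd_right h4 _, ?_⟩
    rwa [(PadicInt.isUnit_iff_not_dvd.2 hb').dvd_mul_left]
  · rintro ⟨b, c, hx, hb, hc, hc'⟩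
    rw [mem_padicForms_iff_of_isEquiv hx]
    refine ⟨1, _, ⟨?_, ?_, ?_, ?_⟩, (one_smul _ _).symm⟩
    · simp [map]
    · simp [map]
    · exact dvd_toZModPow_two_iff.2 hb
    · exact exists_isUnit_toZModPow_two_iff.2 ⟨hc, hc'⟩

/-- The forms `p y`, and the forms `(a, b, p c, p² d)`, whose cubic rings are visibly not maximal. -/
def IsReducible (x : BinaryCubicForm ℤ_[p]) : Prop :=
  (∃ y : BinaryCubicForm ℤ_[p], IsEquiv x ⟨p * y.x₁, p * y.x₂, p * y.x₃, p * y.x₄⟩) ∨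
    ∃ a b c d : ℤ_[p], IsEquiv x ⟨a, b, p * c, p * (p * d)⟩

theorem IsReducible.of_isEquiv {x y : BinaryCubicForm ℤ_[p]} (h : IsEquiv x y)
    (hy : IsReducible y) : IsReducible x := by
  rcases hy with ⟨z, hz⟩ | ⟨a, b, c, d, hz⟩
  exacts [.inl ⟨z, h.trans hz⟩, .inr ⟨a, b, c, d, h.trans hz⟩]

/-- The quadratic factor modulo `p` has no root (type `(21)`), a simple root (type `(111)`), or a
double root. A double root is shifted to `0`, and then divisibility of the constant term by `p²`
separates reducible forms from type `(1²1_max)`. -/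
theorem isReducible_or_of_zero_one (b c : ℤ_[p]) :
    IsReducible (⟨0, 1, b, c⟩ : BinaryCubicForm ℤ_[p]) ∨
      ∃ σ, (⟨0, 1, b, c⟩ : BinaryCubicForm ℤ_[p]) ∈ padicForms p σ := by
  by_cases h : ∃ t, (p : ℤ_[p]) ∣ t ^ 2 + b * t + c
  · obtain ⟨t, ht⟩ := h
    by_cases h' : (p : ℤ_[p]) ∣ b + 2 * t
    · have he := isEquiv_shift_right_quadratic b c t
      by_cases h2 : (p : ℤ_[p]) ^ 2 ∣ t ^ 2 + b * t + c
      · left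
        obtain ⟨b', hb'⟩ := h'
        obtain ⟨c', hc'⟩ := h2
        rw [hb', hc', pow_two, mul_assoc] at he
        exact .inr ⟨_, _, _, _, he⟩
      · exact .inr ⟨.t121max, mem_padicForms_t121max_iff.2 ⟨_, _, he, h', ht, h2⟩⟩
    · exact .inr ⟨.t111, mem_padicForms_t111_iff.2 (isEquiv_split_of_dvd ht h')⟩
  · push Not at h
    exact .inr ⟨.t21, mem_padicForms_t21_iff.2 ⟨b, c, .refl _, h⟩⟩

theorem isReducible_or_of_isSimpleRoot (x : BinaryCubicForm ℤ_[p]) {P}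
    (hP : (x.map (residueMap p)).IsSimpleRoot P) :
    IsReducible x ∨ ∃ σ, x ∈ padicForms p σ := by
  obtain ⟨b, c, h⟩ := exists_isEquiv_of_isSimpleRoot x hP
  exact (isReducible_or_of_zero_one b c).imp (.of_isEquiv h)
    fun ⟨σ, hσ⟩ => ⟨σ, (mem_padicForms_iff_of_isEquiv h).2 hσ⟩

theorem isReducible_or_mem_padicForms (x : BinaryCubicForm ℤ_[p]) :
    IsReducible x ∨ ∃ σ, x ∈ padicForms p σ := by
  by_cases h0 : x.map (residueMap p) = ⟨0, 0, 0, 0⟩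
  · simp only [map, BinaryCubicForm.mk.injEq, residueMap_eq_zero_iff] at h0
    obtain ⟨⟨a, ha⟩, ⟨b, hb⟩, ⟨c, hc⟩, ⟨d, hd⟩⟩ := h0
    exact .inl (.inl ⟨⟨a, b, c, d⟩, by
      rw [← ha, ← hb, ← hc, ← hd]; exact .refl _⟩)
  by_cases hr : (x.map (residueMap p)).rootSet = ∅
  · exact .inr ⟨.t3, hr⟩
  obtain ⟨P, hP⟩ := Set.nonempty_iff_ne_empty.2 hr
  by_cases hs : (x.map (residueMap p)).IsSimpleRoot P
  · exact isReducible_or_of_isSimpleRoot x hs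
  induction P using Projectivization.ind with
  | h w hw =>
  rw [mem_rootSet_mk] at hP
  rw [isSimpleRoot_mk] at hs
  simp only [hP, true_and, not_not] at hs
  obtain ⟨r, hr⟩ := residueMap_surjective p (w 0)
  obtain ⟨s, hrs⟩ := residueMap_surjective p (w 1)
  rw [← hr, ← hrs, evalDu_map, evalDv_map, residueMap_eq_zero_iff, residueMap_eq_zero_iff] at hs
  rw [← hr, ← hrs, eval_map, residueMap_eq_zero_iff] at hP
  -- Move the multiple root to `(0 : 1)`: modulo `p` the form becomes `u²(x₁u + x₂v)`. The swap of
  -- variables has determinant `-1`, whence the signs.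
  obtain ⟨y, hxy, h3, h4⟩ : ∃ y, IsEquiv x y ∧ (p : ℤ_[p]) ∣ y.x₃ ∧ (p : ℤ_[p]) ∣ y.x₄ := by
    obtain ⟨g, rfl, rfl⟩ := exists_gl_first_row r s (by
      rw [← residueMap_eq_zero_iff, ← residueMap_eq_zero_iff, hr, hrs]
      rintro ⟨h0, h1⟩
      exact hw (by ext i; fin_cases i <;> simp [h0, h1]))
    refine ⟨⟨-(g • x).x₄, -(g • x).x₃, -(g • x).x₂, -(g • x).x₁⟩, IsEquiv.trans ⟨g, rfl⟩
      (isEquiv_of_matrix 0 1 1 0 (by simp) (by simp [eval]) (by simp [evalDu, evalDv])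
        (by simp [evalDu, evalDv]) (by simp [eval])), ?_, ?_⟩
    · rw [dvd_neg, smul_x₂]
      exact dvd_mul_of_dvd_right (dvd_add (dvd_mul_of_dvd_left hs.1 _)
        (dvd_mul_of_dvd_left hs.2 _)) _
    · rw [dvd_neg, smul_x₁]
      exact dvd_mul_of_dvd_right hP _
  suffices h : IsReducible y ∨ ∃ σ, y ∈ padicForms p σ from
    h.imp (.of_isEquiv hxy) fun ⟨σ, hσ⟩ => ⟨σ, (mem_padicForms_iff_of_isEquiv hxy).2 hσ⟩
  have h0y : ¬ ((p : ℤ_[p]) ∣ y.x₁ ∧ (p : ℤ_[p]) ∣ y.x₂) := by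
    rintro ⟨h1, h2⟩
    apply h0
    obtain ⟨g, hg⟩ := hxy
    have hy : y.map (residueMap p) = ⟨0, 0, 0, 0⟩ := by
      simp only [map, BinaryCubicForm.mk.injEq, residueMap_eq_zero_iff]
      exact ⟨h1, h2, h3, h4⟩
    rwa [← hg, map_smul, ← eq_inv_smul_iff, smul_zero_form] at hy
  by_cases h2 : (p : ℤ_[p]) ∣ y.x₂
  · have h1 := fun h => h0y ⟨h, h2⟩
    have hu := PadicInt.isUnit_iff_not_dvd.2 h1
    by_cases h5 : (p : ℤ_[p]) ^ 2 ∣ y.x₄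
    · obtain ⟨c, hc⟩ := h3
      obtain ⟨d, hd⟩ := h5
      refine .inl (.inr ⟨y.x₁, y.x₂, c, d, ?_⟩)
      rw [← hc, ← mul_assoc, ← pow_two, ← hd]
      exact .refl _
    · refine .inr ⟨.t13max, mem_padicForms_t13max_iff.2 ⟨_, _, _,
        isEquiv_one_of_isUnit y.x₁ y.x₂ y.x₃ y.x₄ hu, h2,
        dvd_mul_of_dvd_right h3 _, dvd_mul_of_dvd_right h4 _, ?_⟩⟩
      rwa [(hu.pow 2).dvd_mul_left]
  -- The zero of the remaining factor `x₁u + x₂v`, which is a simple root because `x₂` is nonzero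
  -- modulo `p`.
  · have hne : ![residueMap p y.x₂, -residueMap p y.x₁] ≠ 0 := fun h =>
      h2 (residueMap_eq_zero_iff.1 (congrFun h 0))
    refine isReducible_or_of_isSimpleRoot y (P := Projectivization.mk (ZMod p) _ hne) ?_
    rw [isSimpleRoot_mk]
    have e3 := residueMap_eq_zero_iff.2 h3
    have e4 := residueMap_eq_zero_iff.2 h4
    rw [← residueMap_eq_zero_iff] at h2
    simp [eval, evalDu, evalDv, map, e3, e4, h2]
    ring

end BinaryCubicForm

/-! ### Adic completeness of finite free algebras, checked on coordinates. -/

section AdicComplete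

theorem Ideal.sModEq_span_singleton_pow_iff {A : Type*} [CommRing A] (r x y : A) (n : ℕ) :
    x ≡ y [SMOD (Ideal.span {r} ^ n • ⊤ : Submodule A A)] ↔ r ^ n ∣ x - y := by
  rw [SModEq.sub_mem, Ideal.span_singleton_pow, smul_eq_mul, Ideal.mul_top,
    Ideal.mem_span_singleton]

/-- A finite free algebra over an adically complete ring is adically complete. -/
theorem IsAdicComplete.of_basis {R A ι : Type*} [CommRing R] [CommRing A] [Algebra R A] [Fintype ι]
    (b : Module.Basis ι R A) (r : R) [IsAdicComplete (Ideal.span {r}) R] :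
    IsAdicComplete (Ideal.span {algebraMap R A r}) A := by
  have hdvd (n : ℕ) (z : A) : algebraMap R A r ^ n ∣ z ↔ ∀ i, r ^ n ∣ b.repr z i := by
    rw [← map_pow]
    constructor
    · rintro ⟨w, rfl⟩ i
      rw [← Algebra.smul_def]
      simp [-AdjoinRoot.algebraMap_eq]
    · intro h
      choose c hc using h
      refine ⟨∑ i, c i • b i, ?_⟩
      rw [← Algebra.smul_def, Finset.smul_sum]
      simp_rw [smul_smul, ← hc, b.sum_repr]
  have hH : IsHausdorff (Ideal.span {algebraMap R A r}) A := by
    refine ⟨fun x hx => b.repr.injective (Finsupp.ext fun i => ?_)⟩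
    rw [map_zero, Finsupp.zero_apply]
    refine IsHausdorff.haus (I := Ideal.span {r}) inferInstance _ fun n => ?_
    have := hx n
    rw [Ideal.sModEq_span_singleton_pow_iff, sub_zero, hdvd] at this
    rw [Ideal.sModEq_span_singleton_pow_iff, sub_zero]
    exact this i
  have hP : IsPrecomplete (Ideal.span {algebraMap R A r}) A := by
    refine ⟨fun f hf => ?_⟩
    have hc (i : ι) : ∃ L : R, ∀ n, b.repr (f n) i ≡ L [SMOD (Ideal.span {r} ^ n • ⊤ : Submodule R R)] := by
      refine IsPrecomplete.prec (I := Ideal.span {r}) inferInstance fun {m n} hmn => ?_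
      have := hf hmn
      rw [Ideal.sModEq_span_singleton_pow_iff, hdvd] at this
      rw [Ideal.sModEq_span_singleton_pow_iff]
      simpa using this i
    choose L hL using hc
    refine ⟨∑ i, L i • b i, fun n => ?_⟩
    rw [Ideal.sModEq_span_singleton_pow_iff, hdvd]
    intro i
    have := hL i n
    rw [Ideal.sModEq_span_singleton_pow_iff] at this
    rw [map_sub, Finsupp.sub_apply, b.repr_sum_self]
    exact this
  exact { haus' := hH.haus', prec' := hP.prec' }

end AdicComplete

/-! ### Quotients of `ℤ_p[X]` by polynomials irreducible modulo `p`. -/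

section Inert

open Polynomial

variable {p : ℕ} [Fact p.Prime] {f g : ℤ_[p][X]}

instance PadicInt.isAdicComplete_span :
    IsAdicComplete (Ideal.span {(p : ℤ_[p])}) ℤ_[p] := by
  rw [← PadicInt.maximalIdeal_eq_span_p]
  infer_instance

variable (f) in
/-- Reduction modulo `p` of `ℤ_p[X]/(f)`. -/
noncomputable def reduceAdjoinRoot :
    AdjoinRoot f →+* AdjoinRoot (f.map (residueMap p)) :=
  AdjoinRoot.map (residueMap p) f _ dvd_rfl

theorem reduceAdjoinRoot_mk (h : ℤ_[p][X]) : reduceAdjoinRoot f (AdjoinRoot.mk f h) =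
    AdjoinRoot.mk _ (h.map (residueMap p)) := by
  rw [reduceAdjoinRoot, AdjoinRoot.map, AdjoinRoot.lift_mk, ← AdjoinRoot.aeval_eq, aeval_def,
    eval₂_map, AdjoinRoot.algebraMap_eq]

theorem reduceAdjoinRoot_surjective : Function.Surjective (reduceAdjoinRoot f) := by
  intro z
  obtain ⟨h, rfl⟩ := AdjoinRoot.mk_surjective z
  obtain ⟨h, rfl⟩ := Polynomial.map_surjective _ (residueMap_surjective p) h
  exact ⟨_, reduceAdjoinRoot_mk h⟩

/-- A polynomial over `ℤ_p` vanishing modulo `p` is divisible by `p`. -/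
theorem exists_eq_C_mul_of_map_eq_zero {h : ℤ_[p][X]} (hh : h.map (residueMap p) = 0) :
    ∃ k, h = C (p : ℤ_[p]) * k := by
  change C (p : ℤ_[p]) ∣ h
  rw [C_dvd_iff_dvd_coeff]
  intro i
  rw [← residueMap_eq_zero_iff, ← coeff_map, hh, coeff_zero]

theorem reduceAdjoinRoot_eq_zero_iff {z : AdjoinRoot f} :
    reduceAdjoinRoot f z = 0 ↔ algebraMap ℤ_[p] (AdjoinRoot f) p ∣ z := by
  constructor
  · intro h
    obtain ⟨k, rfl⟩ := AdjoinRoot.mk_surjective z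
    rw [reduceAdjoinRoot_mk, AdjoinRoot.mk_eq_zero] at h
    obtain ⟨m, hm⟩ := h
    obtain ⟨m, rfl⟩ := Polynomial.map_surjective _ (residueMap_surjective p) m
    rw [← Polynomial.map_mul, ← sub_eq_zero, ← Polynomial.map_sub] at hm
    obtain ⟨l, hl⟩ := exists_eq_C_mul_of_map_eq_zero hm
    refine ⟨AdjoinRoot.mk f l, ?_⟩
    rw [AdjoinRoot.algebraMap_eq, ← AdjoinRoot.mk_C, ← map_mul, ← hl, map_sub, map_mul,
      AdjoinRoot.mk_self, zero_mul, sub_zero]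
  · rintro ⟨w, rfl⟩
    have : reduceAdjoinRoot f (algebraMap ℤ_[p] (AdjoinRoot f) p) = 0 := by
      rw [AdjoinRoot.algebraMap_eq, reduceAdjoinRoot, AdjoinRoot.map_of,
        residueMap_eq_zero_iff.2 dvd_rfl, map_zero]
    rw [map_mul, this, zero_mul]

theorem isAdicComplete_adjoinRoot (hf : f.Monic) :
    IsAdicComplete (Ideal.span {algebraMap ℤ_[p] (AdjoinRoot f) p}) (AdjoinRoot f) :=
  IsAdicComplete.of_basis (AdjoinRoot.powerBasis' hf).basis _

/-- By `p`-adic completeness `p` lies in the Jacobson radical, so an inverse modulo `p` suffices. -/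
theorem isUnit_of_reduceAdjoinRoot (hf : f.Monic) {z : AdjoinRoot f}
    (hz : IsUnit (reduceAdjoinRoot f z)) : IsUnit z := by
  have := isAdicComplete_adjoinRoot hf
  obtain ⟨w, hw⟩ := hz.exists_right_inv
  obtain ⟨w, rfl⟩ := reduceAdjoinRoot_surjective w
  rw [← map_mul, ← map_one (reduceAdjoinRoot f), ← sub_eq_zero, ← map_sub,
    reduceAdjoinRoot_eq_zero_iff, ← Ideal.mem_span_singleton] at hw
  have h2 := IsAdicComplete.le_jacobson_bot _ hw
  rw [Ideal.mem_jacobson_bot] at h2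
  have h3 := h2 1
  rw [mul_one, sub_add_cancel] at h3
  exact isUnit_of_mul_isUnit_left h3

/-- The derivative of an irreducible polynomial modulo `p` is a unit at the root. -/
theorem isUnit_aeval_derivative (hf : f.Monic) (hi : Irreducible (f.map (residueMap p))) :
    IsUnit (aeval (AdjoinRoot.root f) (derivative f)) := by
  have : Fact (Irreducible (f.map (residueMap p))) := ⟨hi⟩
  apply isUnit_of_reduceAdjoinRoot hf
  rw [AdjoinRoot.aeval_eq, reduceAdjoinRoot_mk, isUnit_iff_ne_zero, Ne, AdjoinRoot.mk_eq_zero,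
    ← derivative_map]
  intro h
  have hs : (f.map (residueMap p)).Separable := PerfectField.separable_of_irreducible hi
  exact hi.not_isUnit (hs.isUnit_of_dvd' dvd_rfl h)

/-- Two lifts of the root along a square-zero ideal differ by some `d` with `d² = 0`. Taylor
expansion of `f` leaves `f'(root) d = 0`, and `f'(root)` is a unit. -/
theorem unramified_adjoinRoot (hf : f.Monic) (hi : Irreducible (f.map (residueMap p))) :
    Algebra.Unramified ℤ_[p] (AdjoinRoot f) := by
  have := hf.finite_adjoinRoot
  refine { formallyUnramified := ?_, finiteType := inferInstance }
  rw [Algebra.FormallyUnramified.iff_comp_injective]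
  intro B _ _ I hI g₁ g₂ h
  apply AdjoinRoot.algHom_ext
  have hd : g₁ (AdjoinRoot.root f) - g₂ (AdjoinRoot.root f) ∈ I := by
    rw [← Ideal.Quotient.eq]
    exact DFunLike.congr_fun h (AdjoinRoot.root f)
  set d := g₁ (AdjoinRoot.root f) - g₂ (AdjoinRoot.root f) with hdd
  have hd2 : d ^ 2 = 0 := by
    rw [← Ideal.mem_bot, ← hI]
    exact Ideal.pow_mem_pow hd 2
  obtain ⟨k, hk⟩ := binomExpansion (f.map (algebraMap ℤ_[p] B)) (g₂ (AdjoinRoot.root f)) d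
  rw [hd2, mul_zero, add_zero, hdd, add_sub_cancel, eval_map_algebraMap, eval_map_algebraMap,
    AdjoinRoot.aeval_algHom_eq_zero, AdjoinRoot.aeval_algHom_eq_zero, zero_add, derivative_map,
    eval_map_algebraMap, aeval_algHom_apply, ← hdd] at hk
  have hu := (isUnit_aeval_derivative hf hi).map g₂
  exact sub_eq_zero.1 (hu.mul_right_eq_zero.1 hk.symm)

/-- Hensel's lemma: polynomials of the same degree that are irreducible modulo `p` define isomorphic
extensions of `ℤ_p`. -/
theorem nonempty_adjoinRoot_algEquiv (hf : f.Monic) (hg : g.Monic)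
    (hfi : Irreducible (f.map (residueMap p))) (hgi : Irreducible (g.map (residueMap p)))
    (hd : f.natDegree = g.natDegree) : Nonempty (AdjoinRoot g ≃ₐ[ℤ_[p]] AdjoinRoot f) := by
  have : Fact (Irreducible (f.map (residueMap p))) := ⟨hfi⟩
  have : Fact (Irreducible (g.map (residueMap p))) := ⟨hgi⟩
  have := (hf.map (residueMap p)).finite_adjoinRoot
  have := (hg.map (residueMap p)).finite_adjoinRoot
  have := hf.finite_adjoinRoot
  have := hg.finite_adjoinRoot
  have := hf.free_adjoinRoot
  have := hg.free_adjoinRoot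
  have := isAdicComplete_adjoinRoot hf
  have : Finite (AdjoinRoot (f.map (residueMap p))) := Module.finite_of_finite (ZMod p)
  have : Finite (AdjoinRoot (g.map (residueMap p))) := Module.finite_of_finite (ZMod p)
  have hfr : Module.finrank (ZMod p) (AdjoinRoot (g.map (residueMap p))) =
      Module.finrank (ZMod p) (AdjoinRoot (f.map (residueMap p))) := by
    rw [AdjoinRoot.finrank_eq_natDegree (hf.map _), AdjoinRoot.finrank_eq_natDegree (hg.map _),
      hf.natDegree_map, hg.natDegree_map, hd]
  -- The residue rings are finite fields of the same degree. The image of the root of `g` under `e`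
  -- is an approximate root of `g` in `AdjoinRoot f`, simple by separability, which Hensel's lemma
  -- refines.
  obtain ⟨e⟩ := FiniteField.nonempty_algHom_of_finrank_dvd (F := ZMod p) hfr.dvd
  have hesurj : Function.Surjective e :=
    (LinearMap.injective_iff_surjective_of_finrank_eq_finrank (f := e.toLinearMap) hfr).1 e.injective
  obtain ⟨a₀, ha₀⟩ := reduceAdjoinRoot_surjective (f := f) (e (AdjoinRoot.root _))
  have hred (h : ℤ_[p][X]) (a : AdjoinRoot f) :
      reduceAdjoinRoot f (aeval a h) = aeval (reduceAdjoinRoot f a) (h.map (residueMap p)) := by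
    rw [aeval_def, hom_eval₂, aeval_def, eval₂_map]
    congr 1
    ext r
    simp [reduceAdjoinRoot]
  obtain ⟨a, ha, haa⟩ := HenselianRing.is_henselian
    (I := Ideal.span {algebraMap ℤ_[p] (AdjoinRoot f) p}) (g.map (algebraMap _ _)) (hg.map _) a₀
    (by
      rw [Ideal.mem_span_singleton, ← reduceAdjoinRoot_eq_zero_iff, eval_map_algebraMap, hred, ha₀,
        aeval_algHom_apply, AdjoinRoot.aeval_eq, AdjoinRoot.mk_self, map_zero])
    (by
      apply IsUnit.map
      apply isUnit_of_reduceAdjoinRoot hf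
      rw [derivative_map, eval_map_algebraMap, hred, ha₀, aeval_algHom_apply]
      apply IsUnit.map
      have := (isUnit_aeval_derivative hg hgi).map (reduceAdjoinRoot g)
      rwa [AdjoinRoot.aeval_eq, reduceAdjoinRoot_mk, ← AdjoinRoot.aeval_eq] at this)
  rw [Ideal.mem_span_singleton, ← reduceAdjoinRoot_eq_zero_iff, map_sub, sub_eq_zero, ha₀] at haa
  let ψ : AdjoinRoot g →ₐ[ℤ_[p]] AdjoinRoot f :=
    AdjoinRoot.liftAlgHom g (Algebra.ofId _ _) a (by
      rw [IsRoot, eval_map] at ha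
      exact ha)
  have hψ (h : ℤ_[p][X]) : ψ (AdjoinRoot.mk g h) = aeval a h := rfl
  have hsurj : Function.Surjective ψ := by
    rw [← AlgHom.coe_toLinearMap, ← LinearMap.range_eq_top, eq_top_iff]
    -- Nakayama: modulo `p` the map `ψ` is the surjection `e`.
    refine Submodule.le_of_le_smul_of_le_jacobson_bot (I := Ideal.span {(p : ℤ_[p])})
      Module.Finite.fg_top (IsAdicComplete.le_jacobson_bot _) fun z _ => ?_
    obtain ⟨w, hw⟩ := hesurj (reduceAdjoinRoot f z)
    obtain ⟨h, rfl⟩ := AdjoinRoot.mk_surjective w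
    obtain ⟨h, rfl⟩ := Polynomial.map_surjective _ (residueMap_surjective p) h
    rw [← AdjoinRoot.aeval_eq, ← aeval_algHom_apply, ← haa, ← hred, ← hψ, ← sub_eq_zero,
      ← map_sub, reduceAdjoinRoot_eq_zero_iff] at hw
    obtain ⟨v, hv⟩ := hw
    rw [show z = ψ (AdjoinRoot.mk g h) + (p : ℤ_[p]) • (-v) by
      rw [Algebra.smul_def]; linear_combination -hv]
    exact Submodule.add_mem_sup ⟨AdjoinRoot.mk g h, rfl⟩
      (Submodule.smul_mem_smul (Ideal.mem_span_singleton_self _) trivial)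
  exact ⟨AlgEquiv.ofBijective ψ (LinearMap.bijective_of_surjective_of_finrank_eq
    (by rw [AdjoinRoot.finrank_eq_natDegree hf, AdjoinRoot.finrank_eq_natDegree hg, hd])
    ψ.toLinearMap hsurj)⟩

end Inert

/-! ### Ramification in the Eisenstein case. -/

section Eisenstein

open Polynomial

variable {p : ℕ} [Fact p.Prime] {f : ℤ_[p][X]}

/-- Both `0` and `ε` are roots of `X ^ n`, `n ≥ 2`, in the dual numbers over `𝔽_p`. They define
distinct homomorphisms that agree modulo `ε`. -/
theorem not_unramified_adjoinRoot (hd : 2 ≤ f.natDegree)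
    (he : f.map (residueMap p) = X ^ f.natDegree) :
    ¬ Algebra.Unramified ℤ_[p] (AdjoinRoot f) := by
  intro _
  let _ : Algebra ℤ_[p] (DualNumber (ZMod p)) :=
    ((algebraMap (ZMod p) (DualNumber (ZMod p))).comp (residueMap p)).toAlgebra
  have key (z : DualNumber (ZMod p)) (hz : z ^ 2 = 0) :
      f.eval₂ (Algebra.ofId ℤ_[p] (DualNumber (ZMod p))) z = 0 := by
    have : f.eval₂ (Algebra.ofId ℤ_[p] (DualNumber (ZMod p))) z =
        (f.map (residueMap p)).eval₂ (algebraMap (ZMod p) (DualNumber (ZMod p))) z := by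
      rw [eval₂_map]; rfl
    rw [this, he, eval₂_X_pow]
    exact pow_eq_zero_of_le hd hz
  let g₁ : AdjoinRoot f →ₐ[ℤ_[p]] DualNumber (ZMod p) :=
    AdjoinRoot.liftAlgHom f (Algebra.ofId _ _) 0 (key 0 (by simp))
  let g₂ : AdjoinRoot f →ₐ[ℤ_[p]] DualNumber (ZMod p) :=
    AdjoinRoot.liftAlgHom f (Algebra.ofId _ _) DualNumber.eps (key _ (by simp [pow_two]))
  have h := Algebra.FormallyUnramified.ext (R := ℤ_[p])
    (I := RingHom.ker (TrivSqZeroExt.fstHom (ZMod p) (ZMod p) (ZMod p)))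
    (g₁ := g₁) (g₂ := g₂) ⟨2, ?_⟩ ?_
  · have h1 := DFunLike.congr_fun h (AdjoinRoot.root f)
    have h2 := congrArg TrivSqZeroExt.snd h1
    simp [g₁, g₂] at h2
  · rw [pow_two, Ideal.zero_eq_bot, eq_bot_iff, Ideal.mul_le]
    intro a ha b hb
    rw [RingHom.mem_ker] at ha hb
    rw [Ideal.mem_bot]
    have ha : a.fst = 0 := ha
    have hb : b.fst = 0 := hb
    ext <;> simp [ha, hb]
  · intro z
    have : (Ideal.Quotient.mkₐ ℤ_[p] (RingHom.ker (TrivSqZeroExt.fstHom (ZMod p) (ZMod p) (ZMod p)))).comp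
        g₁ = (Ideal.Quotient.mkₐ ℤ_[p] _).comp g₂ := by
      apply AdjoinRoot.algHom_ext
      simp only [AlgHom.comp_apply, Ideal.Quotient.mkₐ_eq_mk, Ideal.Quotient.eq]
      simp [g₁, g₂, RingHom.mem_ker]
    exact DFunLike.congr_fun this z

end Eisenstein

/-! ### Integer rings of extensions of `ℚ_p` as monogenic algebras. -/

namespace PadicExtension

open Polynomial

variable {p : ℕ} [Fact p.Prime] {n : ℕ} (L : PadicExtension.{u} p n)

instance isTorsionFree_carrier : Module.IsTorsionFree ℤ_[p] L.carrier :=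
  Module.IsTorsionFree.trans_faithfulSMul ℤ_[p] ℚ_[p] L.carrier

instance finite_integers : Module.Finite ℤ_[p] L.integers :=
  IsIntegralClosure.finite ℤ_[p] ℚ_[p] L.carrier L.integers

instance free_integers : Module.Free ℤ_[p] L.integers :=
  IsIntegralClosure.module_free ℤ_[p] ℚ_[p] L.carrier L.integers

instance isFractionRing_integers : IsFractionRing L.integers L.carrier :=
  integralClosure.isFractionRing_of_finite_extension ℚ_[p] L.carrier

theorem finrank_integers : Module.finrank ℤ_[p] L.integers = n :=
  (IsIntegralClosure.rank ℤ_[p] ℚ_[p] L.carrier L.integers).trans L.finrank_eq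

variable {L} in
/-- Extensions with isomorphic integer rings are isomorphic. -/
theorem nonempty_algEquiv_of_integers {L' : PadicExtension.{u} p n}
    (h : Nonempty (L.integers ≃ₐ[ℤ_[p]] L'.integers)) :
    Nonempty (L.carrier ≃ₐ[ℚ_[p]] L'.carrier) :=
  h.map fun e => IsFractionRing.fieldEquivOfAlgEquiv ℚ_[p] L.carrier L'.carrier e

variable {L}

theorem isUnramified_iff_of_algEquiv {A : Type*} [CommRing A] [Algebra ℤ_[p] A]
    (e : L.integers ≃ₐ[ℤ_[p]] A) : L.IsUnramified ↔ Algebra.Unramified ℤ_[p] A :=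
  ⟨fun h => have : Algebra.Unramified ℤ_[p] L.integers := h; .of_equiv e,
    fun _ => .of_equiv e.symm⟩

/-- If `ℤ_p[α]` is `p`-saturated in the integer ring, then it is the integer ring. -/
theorem nonempty_integers_algEquiv {f : ℤ_[p][X]} (B : PowerBasis ℚ_[p] L.carrier)
    (hB : IsIntegral ℤ_[p] B.gen) (hf : minpoly ℤ_[p] B.gen = f)
    (hstep : ∀ z : L.carrier, IsIntegral ℤ_[p] z →
      (p : ℤ_[p]) • z ∈ Algebra.adjoin ℤ_[p] {B.gen} → z ∈ Algebra.adjoin ℤ_[p] {B.gen}) :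
    Nonempty (L.integers ≃ₐ[ℤ_[p]] AdjoinRoot f) := by
  have hpow (k : ℕ) (z : L.carrier) (hz : IsIntegral ℤ_[p] z)
      (h : (p : ℤ_[p]) ^ k • z ∈ Algebra.adjoin ℤ_[p] {B.gen}) :
      z ∈ Algebra.adjoin ℤ_[p] {B.gen} := by
    induction k generalizing z with
    | zero => simpa using h
    | succ k ih => exact hstep z hz (ih _ (hz.smul _) (by rwa [smul_smul, ← pow_succ]))
  have heq : Algebra.adjoin ℤ_[p] {B.gen} = L.integers := by
    refine le_antisymm (adjoin_le_integralClosure hB) fun z hz => ?_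
    obtain ⟨P, hP⟩ := B.exists_eq_aeval' z
    -- Clear denominators; a nonzero `b` is a unit times a power of `p`, so `p`-saturation applies
    -- repeatedly.
    obtain ⟨b, hb, h⟩ := IsLocalization.integerNormalization_spec (nonZeroDivisors ℤ_[p]) P
    have hb0 := nonZeroDivisors.ne_zero hb
    have h1 : b • z ∈ Algebra.adjoin ℤ_[p] {B.gen} := by
      have : b • z = aeval B.gen (IsLocalization.integerNormalization (nonZeroDivisors ℤ_[p]) P) := by
        rw [← aeval_map_algebraMap ℚ_[p], h, hP, ← algebraMap_smul ℚ_[p] b P, map_smul,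
          algebraMap_smul]
      rw [this]
      exact aeval_mem_adjoin_singleton _ _
    rw [PadicInt.unitCoeff_spec hb0] at h1
    refine hpow b.valuation z hz ?_
    have h2 := Subalgebra.smul_mem _ h1 ((PadicInt.unitCoeff hb0)⁻¹ : ℤ_[p]ˣ).1
    rwa [smul_smul, ← mul_assoc, Units.inv_mul, one_mul] at h2
  subst hf
  exact ⟨((minpoly.equivAdjoin hB).trans (Subalgebra.equivOfEq _ _ heq)).symm⟩

theorem not_isIntegral_inv_natCast (z : L.carrier) (hz : IsIntegral ℤ_[p] z)
    (h : (p : ℤ_[p]) • z = 1) : False := by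
  have hz' : z = algebraMap ℚ_[p] L.carrier (p : ℚ_[p])⁻¹ := by
    have hp : (p : ℚ_[p]) ≠ 0 := by exact_mod_cast (Fact.out : p.Prime).ne_zero
    rw [map_inv₀, eq_comm, inv_eq_iff_eq_inv, ← mul_eq_one_iff_eq_inv₀]
    · rw [← h, Algebra.smul_def, IsScalarTower.algebraMap_apply ℤ_[p] ℚ_[p]]
      simp
    · rintro rfl
      simp at h
  rw [hz', isIntegral_algebraMap_iff (algebraMap ℚ_[p] L.carrier).injective,
    IsIntegrallyClosed.isIntegral_iff] at hz
  obtain ⟨y, hy⟩ := hz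
  have : (p : ℤ_[p]) * y = 1 := by
    apply IsFractionRing.injective ℤ_[p] ℚ_[p]
    have hp : (p : ℚ_[p]) ≠ 0 := by exact_mod_cast (Fact.out : p.Prime).ne_zero
    rw [map_mul, hy, map_one, map_natCast, mul_inv_cancel₀ hp]
  exact PadicInt.prime_p.not_isUnit (.of_mul_eq_one _ this)

/-- Write `p z = h(α)`. If `f` divides `h` modulo `p`, then `h = f k + p m` and `z = m(α)`.
Otherwise they are coprime modulo `p`, and a Bézout relation `a f + b h = 1 + p r` evaluated at `α`
makes `1/p` integral, which is impossible. -/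
theorem mem_adjoin_of_smul_mem_of_irreducible_map {f : ℤ_[p][X]} {α : L.carrier}
    (hα : IsIntegral ℤ_[p] α) (hf : aeval α f = 0) (hi : Irreducible (f.map (residueMap p)))
    {z : L.carrier} (hz : IsIntegral ℤ_[p] z) (h : (p : ℤ_[p]) • z ∈ Algebra.adjoin ℤ_[p] {α}) :
    z ∈ Algebra.adjoin ℤ_[p] {α} := by
  rw [Algebra.adjoin_singleton_eq_range_aeval] at h
  obtain ⟨h, hh⟩ := h
  have hh : aeval α h = (p : ℤ_[p]) • z := hh
  by_cases hd : f.map (residueMap p) ∣ h.map (residueMap p)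
  · obtain ⟨k, hk⟩ := hd
    obtain ⟨k, rfl⟩ := Polynomial.map_surjective _ (residueMap_surjective p) k
    rw [← Polynomial.map_mul, ← sub_eq_zero, ← Polynomial.map_sub] at hk
    obtain ⟨m, hm⟩ := exists_eq_C_mul_of_map_eq_zero hk
    have hz' : (p : ℤ_[p]) • z = (p : ℤ_[p]) • aeval α m := by
      have := congrArg (aeval α) hm
      rwa [map_sub, map_mul, hf, zero_mul, sub_zero, hh, map_mul, aeval_C,
        ← Algebra.smul_def] at this
    rw [smul_right_injective _ PadicInt.prime_p.ne_zero hz']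
    exact aeval_mem_adjoin_singleton _ _
  · exfalso
    obtain ⟨a, b, hab⟩ := (hi.coprime_iff_not_dvd).2 hd
    obtain ⟨a, rfl⟩ := Polynomial.map_surjective _ (residueMap_surjective p) a
    obtain ⟨b, rfl⟩ := Polynomial.map_surjective _ (residueMap_surjective p) b
    rw [← Polynomial.map_mul, ← Polynomial.map_mul, ← Polynomial.map_add, ← sub_eq_zero,
      ← Polynomial.map_one (residueMap p), ← Polynomial.map_sub] at hab
    obtain ⟨r, hr⟩ := exists_eq_C_mul_of_map_eq_zero hab
    have := congrArg (aeval α) hr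
    simp only [map_sub, map_add, map_mul, hf, mul_zero, zero_add, hh, map_one, aeval_C] at this
    have hint (q : ℤ_[p][X]) : IsIntegral ℤ_[p] (aeval α q) :=
      adjoin_le_integralClosure hα (aeval_mem_adjoin_singleton _ _)
    refine not_isIntegral_inv_natCast (aeval α b * z - aeval α r)
      (((hint b).mul hz).sub (hint r)) ?_
    rw [Algebra.smul_def] at this ⊢
    linear_combination this

theorem isIntegral_and_minpoly_eq {f : ℤ_[p][X]} (B : PowerBasis ℚ_[p] L.carrier) (hf : f.Monic)
    (hi : Irreducible (f.map (algebraMap ℤ_[p] ℚ_[p])))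
    (h : aeval B.gen (f.map (algebraMap ℤ_[p] ℚ_[p])) = 0) :
    IsIntegral ℤ_[p] B.gen ∧ minpoly ℤ_[p] B.gen = f := by
  have hint : IsIntegral ℤ_[p] B.gen := ⟨f, hf, by rwa [aeval_map_algebraMap] at h⟩
  refine ⟨hint, Polynomial.map_injective _ (IsFractionRing.injective ℤ_[p] ℚ_[p]) ?_⟩
  rw [← minpoly.isIntegrallyClosed_eq_field_fractions' ℚ_[p] hint]
  exact (minpoly.eq_of_irreducible_of_monic hi h (hf.map _)).symm

/-- A monic irreducible polynomial over `ℤ_p` defines an extension of `ℚ_p`. -/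
theorem exists_of_irreducible {f : ℤ_[p][X]} (hf : f.Monic) (hi : Irreducible f)
    (hn : f.natDegree = n) :
    ∃ (L : PadicExtension.{u} p n) (B : PowerBasis ℚ_[p] L.carrier),
      IsIntegral ℤ_[p] B.gen ∧ minpoly ℤ_[p] B.gen = f := by
  have hi' : Irreducible (f.map (algebraMap ℤ_[p] ℚ_[p])) :=
    hf.irreducible_iff_irreducible_map_fraction_map.1 hi
  have : Fact (Irreducible (f.map (algebraMap ℤ_[p] ℚ_[p]))) := ⟨hi'⟩
  let B₀ := AdjoinRoot.powerBasis hi'.ne_zero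
  let B : PowerBasis ℚ_[p] (ULift.{u} (AdjoinRoot (f.map (algebraMap ℤ_[p] ℚ_[p])))) :=
    B₀.map ULift.algEquiv.symm
  have := B.finite
  let L : PadicExtension.{u} p n :=
    { carrier := ULift.{u} (AdjoinRoot (f.map (algebraMap ℤ_[p] ℚ_[p])))
      finrank_eq := by
        rw [B.finrank, PowerBasis.map_dim, AdjoinRoot.powerBasis_dim, hf.natDegree_map, hn] }
  refine ⟨L, B, isIntegral_and_minpoly_eq (L := L) B hf hi' ?_⟩
  rw [PowerBasis.map_gen, ← AlgEquiv.coe_toAlgHom, aeval_algHom_apply, AdjoinRoot.powerBasis_gen,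
    AdjoinRoot.aeval_eq, AdjoinRoot.mk_self, map_zero]

theorem isUnramified_of_algEquiv {f : ℤ_[p][X]} (hf : f.Monic)
    (hi : Irreducible (f.map (residueMap p))) (e : L.integers ≃ₐ[ℤ_[p]] AdjoinRoot f) :
    L.IsUnramified :=
  (isUnramified_iff_of_algEquiv e).2 (unramified_adjoinRoot hf hi)

theorem not_isUnramified_of_algEquiv {f : ℤ_[p][X]} (hf : f.Monic) (h2 : 2 ≤ f.natDegree)
    (he : f.IsEisensteinAt (Ideal.span {(p : ℤ_[p])})) (e : L.integers ≃ₐ[ℤ_[p]] AdjoinRoot f) :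
    ¬ L.IsUnramified := by
  rw [isUnramified_iff_of_algEquiv e]
  refine not_unramified_adjoinRoot h2 ?_
  ext i
  rw [coeff_map, coeff_X_pow]
  split_ifs with hi
  · rw [hi, hf.coeff_natDegree, map_one]
  · rcases lt_or_gt_of_ne hi with hi | hi
    · exact residueMap_eq_zero_iff.2 (Ideal.mem_span_singleton.1 (he.mem hi))
    · rw [coeff_eq_zero_of_natDegree_lt hi, map_zero]

theorem exists_isUnramified {f : ℤ_[p][X]} (hf : f.Monic)
    (hi : Irreducible (f.map (residueMap p))) (hn : f.natDegree = n) :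
    ∃ L : PadicExtension.{u} p n, L.IsUnramified ∧
      Nonempty (L.integers ≃ₐ[ℤ_[p]] AdjoinRoot f) := by
  obtain ⟨L, B, hB, hBf⟩ := exists_of_irreducible hf (hf.irreducible_of_irreducible_map _ _ hi) hn
  have ⟨e⟩ := nonempty_integers_algEquiv B hB hBf fun z hz h =>
    mem_adjoin_of_smul_mem_of_irreducible_map hB (hBf ▸ minpoly.aeval _ _) hi hz h
  exact ⟨L, isUnramified_of_algEquiv hf hi e, ⟨e⟩⟩

theorem exists_not_isUnramified {f : ℤ_[p][X]} (hf : f.Monic) (h2 : 2 ≤ f.natDegree)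
    (he : f.IsEisensteinAt (Ideal.span {(p : ℤ_[p])})) (hn : f.natDegree = n) :
    ∃ L : PadicExtension.{u} p n, ¬ L.IsUnramified ∧
      Nonempty (L.integers ≃ₐ[ℤ_[p]] AdjoinRoot f) := by
  obtain ⟨L, B, hB, hBf⟩ := exists_of_irreducible hf (he.irreducible
    ((Ideal.span_singleton_prime PadicInt.prime_p.ne_zero).2 PadicInt.prime_p) hf.isPrimitive
    (by omega)) hn
  have ⟨e⟩ := nonempty_integers_algEquiv B hB hBf fun z hz h =>
    mem_adjoin_of_smul_prime_smul_of_minpoly_isEisensteinAt PadicInt.prime_p hB hz h (hBf ▸ he)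
  exact ⟨L, not_isUnramified_of_algEquiv hf h2 he e, ⟨e⟩⟩

end PadicExtension

/-! ### Bases of finite free `ℤ_p`-algebras containing `1`. -/

section Basis

variable {p : ℕ} [Fact p.Prime]

/-- A nonzero finite free `ℤ_p`-algebra has a basis containing `1`. -/
theorem exists_basis_zero_eq_one {A : Type*} [CommRing A] [Algebra ℤ_[p] A] {n : ℕ}
    (b : Module.Basis (Fin (n + 1)) ℤ_[p] A) :
    ∃ b' : Module.Basis (Fin (n + 1)) ℤ_[p] A, b' 0 = 1 := by
  -- Otherwise `1`, hence also the basis vector `b 0`, would be a multiple of `p`.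
  obtain ⟨i, hi⟩ : ∃ i, IsUnit (b.repr 1 i) := by
    by_contra! h
    simp only [PadicInt.isUnit_iff_not_dvd, not_not] at h
    choose c hc using h
    have h1 : (1 : A) = (p : ℤ_[p]) • ∑ i, c i • b i := by
      conv_lhs => rw [← b.sum_repr 1]
      rw [Finset.smul_sum]
      simp_rw [smul_smul, ← hc]
    have h2 : b 0 = (p : ℤ_[p]) • ((∑ i, c i • b i) * b 0) := by
      rw [← smul_mul_assoc, ← h1, one_mul]
    have h3 := congrArg (fun z => b.repr z 0) h2
    simp only [Module.Basis.repr_self, Finsupp.single_eq_same, map_smul, Finsupp.smul_apply,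
      smul_eq_mul] at h3
    exact PadicInt.prime_p.not_isUnit (.of_mul_eq_one _ h3.symm)
  have hdet : b.det (Function.update b i 1) = b.repr 1 i := by
    rw [Module.Basis.det_apply, Module.Basis.toMatrix_update, Module.Basis.toMatrix_self,
      ← Matrix.cramer_apply, Matrix.cramer_one]
    rfl
  obtain ⟨hli, hsp⟩ := b.is_basis_iff_det.2 (hdet ▸ hi)
  refine ⟨(Module.Basis.mk hli hsp.ge).reindex (Equiv.swap i 0), ?_⟩
  simp

end Basis

/-! ### Maximality of cubic rings. -/

section Cubic

open BinaryCubicForm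

variable {p : ℕ} [Fact p.Prime]

theorem IsCubicRing.exists_correspondsTo {A : Type*} [CommRing A] [Algebra ℤ_[p] A]
    (hA : IsCubicRing p A) : ∃ x : BinaryCubicForm ℤ_[p], x.CorrespondsTo A := by
  obtain ⟨b⟩ := hA
  obtain ⟨b', hb'⟩ := exists_basis_zero_eq_one b
  exact exists_correspondsTo_of_basis b' hb'

theorem IsCubicRing.of_finrank_eq {A : Type*} [CommRing A] [Algebra ℤ_[p] A]
    [Module.Free ℤ_[p] A] [Module.Finite ℤ_[p] A] (h : Module.finrank ℤ_[p] A = 3) :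
    IsCubicRing p A :=
  ⟨Module.finBasisOfFinrankEq _ _ h⟩

/-- Both modules have rank `3`, so the quotient has rank `0` and is torsion. -/
theorem exists_ne_zero_smul_mem {B : Type*} [CommRing B] [Algebra ℤ_[p] B]
    (hB : IsCubicRing p B) (T : Subalgebra ℤ_[p] B) (hT : IsCubicRing p T) (b : B) :
    ∃ c : ℤ_[p], c ≠ 0 ∧ c • b ∈ T := by
  obtain ⟨bB⟩ := hB
  obtain ⟨bT⟩ := hT
  have := Module.Finite.of_basis bB
  have h := Submodule.finrank_quotient_add_finrank (Subalgebra.toSubmodule T)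
  have hT3 : Module.finrank ℤ_[p] (Subalgebra.toSubmodule T) = 3 := by
    exact (Module.finrank_eq_card_basis bT).trans (Fintype.card_fin 3)
  rw [Module.finrank_eq_card_basis bB, hT3, Fintype.card_fin, Nat.add_eq_right,
    Module.finrank_eq_zero_iff] at h
  obtain ⟨c, hc, h⟩ := h (Submodule.Quotient.mk b)
  rw [← Submodule.Quotient.mk_smul, Submodule.Quotient.mk_eq_zero] at h
  exact ⟨c, hc, h⟩

open Polynomial in
/-- A cubic ring that is integrally closed in an algebra in which `p` is invertible is maximal. -/
theorem IsMaximalCubicRing.of_isIntegral_mem_range {A : Type u} [CommRing A] [Algebra ℤ_[p] A]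
    {K : Type*} [CommRing K] [Algebra ℤ_[p] K] (hA : IsCubicRing p A)
    (hu : IsUnit (algebraMap ℤ_[p] K p)) (ι : A →ₐ[ℤ_[p]] K) (hι : Function.Injective ι)
    (hint : ∀ y : K, IsIntegral ℤ_[p] y → ∃ a, ι a = y) : IsMaximalCubicRing p A := by
  refine ⟨hA, fun B _ _ hB T ⟨e⟩ => ?_⟩
  have hT : IsCubicRing p T := hA.map fun b => b.map e.toLinearEquiv
  have hBfin : Module.Finite ℤ_[p] B := hB.elim fun b => .of_basis b
  have hBfree : Module.Free ℤ_[p] B := hB.elim fun b => .of_basis b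
  -- If `p b` corresponds to `a`, then `ι a / p` satisfies the same monic equation as `b`. Being
  -- integral it equals some `ι a'`, and then `b = e a'` lies in `T`.
  have hstep (b : B) (h : (p : ℤ_[p]) • b ∈ T) : b ∈ T := by
    obtain ⟨a, ha⟩ := e.surjective ⟨_, h⟩
    obtain ⟨g, hg, hgb⟩ := Algebra.IsIntegral.isIntegral (R := ℤ_[p]) b
    have h1 : aeval ((p : ℤ_[p]) • b) (g.scaleRoots p) = 0 := by
      rw [Algebra.smul_def]
      exact scaleRoots_aeval_eq_zero hgb
    have h2 : aeval a (g.scaleRoots p) = 0 := by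
      have hinj : Function.Injective (T.val.comp e.toAlgHom) :=
        Subtype.val_injective.comp e.injective
      apply hinj
      rw [← aeval_algHom_apply, map_zero, ← h1]
      congr 2
      exact congrArg Subtype.val ha
    obtain ⟨q, hq⟩ := hu.exists_right_inv
    have h3 : aeval (ι a * q) g = 0 := by
      have h4 : aeval (ι a) (g.scaleRoots p) = 0 := by rw [aeval_algHom_apply, h2, map_zero]
      have h5 : ι a = algebraMap ℤ_[p] K p * (ι a * q) := by linear_combination (-ι a) * hq
      rw [h5, aeval_def, scaleRoots_eval₂_mul] at h4
      exact (hu.pow _).mul_right_eq_zero.1 h4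
    obtain ⟨a', ha'⟩ := hint _ ⟨g, hg, h3⟩
    have h6 : a = (p : ℤ_[p]) • a' := by
      apply hι
      rw [_root_.map_smul, ha', Algebra.smul_def]
      linear_combination (-ι a) * hq
    have h7 : (p : ℤ_[p]) • b = (p : ℤ_[p]) • (e a' : B) := by
      rw [h6, _root_.map_smul] at ha
      exact (congrArg Subtype.val ha).symm
    rw [smul_right_injective _ PadicInt.prime_p.ne_zero h7]
    exact (e a').2
  have hpow (k : ℕ) (b : B) (h : (p : ℤ_[p]) ^ k • b ∈ T) : b ∈ T := by
    induction k generalizing b with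
    | zero => simpa using h
    | succ k ih => exact hstep b (ih _ (by rwa [smul_smul, ← pow_succ]))
  rw [eq_top_iff]
  intro b _
  obtain ⟨c, hc, h⟩ := exists_ne_zero_smul_mem hB T hT b
  rw [PadicInt.unitCoeff_spec hc] at h
  refine hpow c.valuation b ?_
  have h2 := Subalgebra.smul_mem _ h ((PadicInt.unitCoeff hc)⁻¹ : ℤ_[p]ˣ).1
  rwa [smul_smul, ← mul_assoc, Units.inv_mul, one_mul] at h2

theorem isUnit_algebraMap_natCast (K : Type*) [CommRing K] [Algebra ℤ_[p] K] [Algebra ℚ_[p] K]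
    [IsScalarTower ℤ_[p] ℚ_[p] K] : IsUnit (algebraMap ℤ_[p] K p) := by
  rw [IsScalarTower.algebraMap_apply ℤ_[p] ℚ_[p] K]
  refine IsUnit.map _ (isUnit_iff_ne_zero.2 ?_)
  simpa using (Fact.out : p.Prime).ne_zero

theorem exists_algebraMap_eq_of_isIntegral {y : ℚ_[p]} (hy : IsIntegral ℤ_[p] y) :
    ∃ a, algebraMap ℤ_[p] ℚ_[p] a = y :=
  IsIntegrallyClosed.isIntegral_iff.1 hy

theorem isMaximalCubicRing_integers (L : PadicExtension.{u} p 3) :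
    IsMaximalCubicRing p L.integers :=
  .of_isIntegral_mem_range (.of_finrank_eq L.finrank_integers)
    (isUnit_algebraMap_natCast L.carrier) L.integers.val Subtype.val_injective
    fun y hy => ⟨⟨y, hy⟩, rfl⟩

theorem isMaximalCubicRing_integers_prod (F : PadicExtension.{u} p 2) :
    IsMaximalCubicRing p (F.integers × ℤ_[p]) := by
  refine .of_isIntegral_mem_range (.of_finrank_eq ?_)
    (isUnit_algebraMap_natCast (F.carrier × ℚ_[p]))
    (F.integers.val.prodMap (Algebra.ofId ℤ_[p] ℚ_[p]))
    (Subtype.val_injective.prodMap (IsFractionRing.injective ℤ_[p] ℚ_[p])) fun y hy => ?_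
  · rw [Module.finrank_prod, F.finrank_integers, Module.finrank_self]
  · obtain ⟨a, ha⟩ := exists_algebraMap_eq_of_isIntegral (hy.map (AlgHom.snd ℤ_[p] F.carrier ℚ_[p]))
    exact ⟨(⟨y.1, hy.map (AlgHom.fst ℤ_[p] F.carrier ℚ_[p])⟩, a), Prod.ext rfl ha⟩

theorem isMaximalCubicRing_ulift_fin_three :
    IsMaximalCubicRing p (ULift.{u} (Fin 3 → ℤ_[p])) := by
  refine .of_isIntegral_mem_range ⟨(Pi.basisFun ℤ_[p] (Fin 3)).map ULift.moduleEquiv.symm⟩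
    (isUnit_algebraMap_natCast (Fin 3 → ℚ_[p]))
    (((Algebra.ofId ℤ_[p] ℚ_[p]).compLeft (Fin 3)).comp ULift.algEquiv.toAlgHom) ?_ fun y hy => ?_
  · exact (Function.Injective.comp_left (IsFractionRing.injective ℤ_[p] ℚ_[p])).comp
      ULift.down_injective
  · choose a ha using fun i =>
      exists_algebraMap_eq_of_isIntegral (hy.map (Pi.evalAlgHom ℤ_[p] (fun _ : Fin 3 => ℚ_[p]) i))
    exact ⟨⟨a⟩, funext ha⟩

theorem IsMaximalCubicRing.of_algEquiv {A B : Type u} [CommRing A] [Algebra ℤ_[p] A]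
    [CommRing B] [Algebra ℤ_[p] B] (hB : IsMaximalCubicRing p B) (e : A ≃ₐ[ℤ_[p]] B) :
    IsMaximalCubicRing p A :=
  ⟨hB.isCubicRing.map fun b => b.map e.symm.toLinearEquiv,
    fun C _ _ hC T ⟨f⟩ => hB.eq_top_of_equiv C hC T ⟨e.symm.trans f⟩⟩

/-- Maximality applied to the image of `A` in the ring of `y`; `ULift` only adjusts the universe. -/
theorem IsMaximalCubicRing.surjective_of_injective {A : Type u} [CommRing A] [Algebra ℤ_[p] A]
    (hA : IsMaximalCubicRing p A) {x y : BinaryCubicForm ℤ_[p]} (hx : x.CorrespondsTo A)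
    (j : CubicRing x →ₐ[ℤ_[p]] CubicRing y) (hj : Function.Injective j) : Function.Surjective j := by
  obtain ⟨e⟩ := hx
  let f : A →ₐ[ℤ_[p]] ULift.{u} (CubicRing y) :=
    ULift.algEquiv.symm.toAlgHom.comp (j.comp e.symm.toAlgHom)
  have hf : Function.Injective f :=
    ULift.up_injective.comp (hj.comp e.symm.injective)
  have htop := hA.eq_top_of_equiv (ULift.{u} (CubicRing y))
    ⟨(CubicRing.basis y).map ULift.moduleEquiv.symm⟩ f.range ⟨AlgEquiv.ofInjective f hf⟩
  intro s
  obtain ⟨a, ha⟩ : ULift.up s ∈ f.range := htop ▸ trivial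
  exact ⟨e.symm a, congrArg ULift.down ha⟩

/-- Each shape of a reducible form comes with an injection into another cubic ring, `scaleHom` or
`partialScaleHom`, whose image misses `θ` because `p` is not a unit. -/
theorem IsMaximalCubicRing.not_isReducible {A : Type u} [CommRing A] [Algebra ℤ_[p] A]
    (hA : IsMaximalCubicRing p A) {x : BinaryCubicForm ℤ_[p]} (hx : x.CorrespondsTo A) :
    ¬ IsReducible x := by
  have hp := (PadicInt.prime_p (p := p)).ne_zero
  rintro (⟨y, hy⟩ | ⟨a, b, c, d, hy⟩)
  · obtain ⟨s, hs⟩ := hA.surjective_of_injective (hy.correspondsTo_iff.1 hx)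
      (CubicRing.scaleHom (p : ℤ_[p]) y) (fun s t h => by
        simp only [CubicRing.scaleHom_apply, CubicRing.ext_iff] at h
        exact CubicRing.ext h.1 (mul_left_cancel₀ hp h.2.1) (mul_left_cancel₀ hp h.2.2)) ⟨0, 0, 1⟩
    rw [CubicRing.scaleHom_apply, CubicRing.ext_iff] at hs
    exact PadicInt.prime_p.not_isUnit (.of_mul_eq_one _ hs.2.2)
  · obtain ⟨s, hs⟩ := hA.surjective_of_injective (hy.correspondsTo_iff.1 hx)
      (CubicRing.partialScaleHom (p : ℤ_[p]) a b c d) (fun s t h => by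
        simp only [CubicRing.partialScaleHom_apply, CubicRing.ext_iff] at h
        exact CubicRing.ext h.1 h.2.1 (mul_left_cancel₀ hp h.2.2)) ⟨0, 0, 1⟩
    rw [CubicRing.partialScaleHom_apply, CubicRing.ext_iff] at hs
    exact PadicInt.prime_p.not_isUnit (.of_mul_eq_one _ hs.2.2)

/-- The form of a maximal cubic ring is of one of the five types. -/
theorem IsMaximalCubicRing.exists_mem_padicForms {A : Type u} [CommRing A] [Algebra ℤ_[p] A]
    (hA : IsMaximalCubicRing p A) {x : BinaryCubicForm ℤ_[p]} (hx : x.CorrespondsTo A) :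
    ∃ σ, x ∈ padicForms p σ :=
  (isReducible_or_mem_padicForms x).resolve_left (hA.not_isReducible hx)

end Cubic

/-! ### Irreducibility and Eisenstein criteria for the polynomials of normal forms. -/

section Polynomials

open Polynomial BinaryCubicForm

variable {p : ℕ} [Fact p.Prime]

theorem irreducible_map_residueMap {f : ℤ_[p][X]} (hf : f.Monic) (h2 : 2 ≤ f.natDegree)
    (h3 : f.natDegree ≤ 3) (h : ∀ t, ¬ (p : ℤ_[p]) ∣ f.eval t) :
    Irreducible (f.map (residueMap p)) := by
  rw [(hf.map _).irreducible_iff_roots_eq_zero_of_degree_le_three (by rwa [hf.natDegree_map])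
    (by rwa [hf.natDegree_map]), Multiset.eq_zero_iff_forall_notMem]
  intro s hs
  obtain ⟨t, rfl⟩ := residueMap_surjective p s
  have := isRoot_of_mem_roots hs
  rw [IsRoot, Polynomial.eval_map, eval₂_at_apply, residueMap_eq_zero_iff] at this
  exact h t this

theorem irreducible_map_monicCubic {b c d : ℤ_[p]}
    (h : ∀ t, ¬ (p : ℤ_[p]) ∣ t ^ 3 + b * t ^ 2 + c * t + d) :
    Irreducible ((monicCubic b c d).map (residueMap p)) := by
  refine irreducible_map_residueMap (monic_monicCubic b c d) ?_ ?_ fun t => ?_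
  · rw [natDegree_monicCubic]; norm_num
  · rw [natDegree_monicCubic]
  · simpa [monicCubic] using h t

theorem irreducible_map_monicQuadratic {b c : ℤ_[p]}
    (h : ∀ t, ¬ (p : ℤ_[p]) ∣ t ^ 2 + b * t + c) :
    Irreducible ((monicQuadratic b c).map (residueMap p)) := by
  refine irreducible_map_residueMap (monic_monicQuadratic b c) ?_ ?_ fun t => ?_
  · rw [natDegree_monicQuadratic]
  · rw [natDegree_monicQuadratic]; norm_num
  -- The sign change reflects the `-b` in `monicQuadratic`.
  · simpa [monicQuadratic, sub_eq_add_neg] using h (-t)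

theorem isEisensteinAt_monicCubic {b c d : ℤ_[p]} (hb : (p : ℤ_[p]) ∣ b) (hc : (p : ℤ_[p]) ∣ c)
    (hd : (p : ℤ_[p]) ∣ d) (hd2 : ¬ (p : ℤ_[p]) ^ 2 ∣ d) :
    (monicCubic b c d).IsEisensteinAt (Ideal.span {(p : ℤ_[p])}) where
  leading := by
    rw [(monic_monicCubic b c d).leadingCoeff, Ideal.mem_span_singleton]
    exact PadicInt.prime_p.not_dvd_one
  mem {n} hn := by
    rw [natDegree_monicCubic] at hn
    rw [Ideal.mem_span_singleton]
    interval_cases n <;> simpa [monicCubic, coeff_X, coeff_C, coeff_X_pow]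
  notMem := by
    rw [Ideal.span_singleton_pow, Ideal.mem_span_singleton]
    simpa [monicCubic]

theorem isEisensteinAt_monicQuadratic {b c : ℤ_[p]} (hb : (p : ℤ_[p]) ∣ b)
    (hc : (p : ℤ_[p]) ∣ c) (hc2 : ¬ (p : ℤ_[p]) ^ 2 ∣ c) :
    (monicQuadratic b c).IsEisensteinAt (Ideal.span {(p : ℤ_[p])}) where
  leading := by
    rw [(monic_monicQuadratic b c).leadingCoeff, Ideal.mem_span_singleton]
    exact PadicInt.prime_p.not_dvd_one
  mem {n} hn := by
    rw [natDegree_monicQuadratic] at hn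
    rw [Ideal.mem_span_singleton]
    interval_cases n <;> simpa [monicQuadratic, coeff_X, coeff_C, coeff_X_pow]
  notMem := by
    rw [Ideal.span_singleton_pow, Ideal.mem_span_singleton]
    simpa [monicQuadratic]

-- Lift the minimal polynomial of a primitive element of the field with `p ^ n` elements.
variable (p) in
theorem exists_monic_irreducible_map (n : ℕ) (hn : n ≠ 0) :
    ∃ f : ℤ_[p][X], f.Monic ∧ f.natDegree = n ∧ Irreducible (f.map (residueMap p)) := by
  obtain ⟨α, hα⟩ := Field.exists_primitive_element (ZMod p) (GaloisField p n)
  rw [Field.primitive_element_iff_minpoly_natDegree_eq, GaloisField.finrank p hn] at hα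
  have hint : IsIntegral (ZMod p) α := .of_finite _ _
  obtain ⟨f, hf, hfd, hfm⟩ := lifts_and_natDegree_eq_and_monic
    ((mem_lifts _).2 (Polynomial.map_surjective _ (residueMap_surjective p) _)) (minpoly.monic hint)
  exact ⟨f, hfm, hfd.trans hα, hf ▸ minpoly.irreducible hint⟩

end Polynomials

/-! ### The rings of forms of each type. -/

namespace BinaryCubicForm

open Polynomial

variable {p : ℕ} [Fact p.Prime] {x : BinaryCubicForm ℤ_[p]}

theorem CorrespondsTo.of_algEquiv {R A B : Type*} [CommRing R] [CommRing A] [Algebra R A]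
    [CommRing B] [Algebra R B] {x : BinaryCubicForm R} (h : x.CorrespondsTo A) (e : A ≃ₐ[R] B) :
    x.CorrespondsTo B :=
  h.map fun f => f.trans e

theorem exists_isUnramified_of_mem_t3 (hx : x ∈ padicForms p .t3) :
    ∃ L : PadicExtension.{u} p 3, L.IsUnramified ∧ x.CorrespondsTo L.integers := by
  obtain ⟨b, c, d, h, hroot⟩ := mem_padicForms_t3_iff.1 hx
  obtain ⟨L, hL, ⟨e⟩⟩ := PadicExtension.exists_isUnramified (monic_monicCubic b c d)
    (irreducible_map_monicCubic hroot) (natDegree_monicCubic b c d)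
  exact ⟨L, hL, h.correspondsTo_iff.2
    ((correspondsTo_adjoinRoot_monicCubic b c d).of_algEquiv e.symm)⟩

theorem exists_not_isUnramified_of_mem_t13max (hx : x ∈ padicForms p .t13max) :
    ∃ L : PadicExtension.{u} p 3, ¬ L.IsUnramified ∧ x.CorrespondsTo L.integers := by
  obtain ⟨b, c, d, h, hb, hc, hd, hd2⟩ := mem_padicForms_t13max_iff.1 hx
  obtain ⟨L, hL, ⟨e⟩⟩ := PadicExtension.exists_not_isUnramified (monic_monicCubic b c d)
    (by rw [natDegree_monicCubic]; norm_num) (isEisensteinAt_monicCubic hb hc hd hd2)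
    (natDegree_monicCubic b c d)
  exact ⟨L, hL, h.correspondsTo_iff.2
    ((correspondsTo_adjoinRoot_monicCubic b c d).of_algEquiv e.symm)⟩

theorem exists_isUnramified_of_mem_t21 (hx : x ∈ padicForms p .t21) :
    ∃ F : PadicExtension.{u} p 2, F.IsUnramified ∧ x.CorrespondsTo (F.integers × ℤ_[p]) := by
  obtain ⟨b, c, h, hroot⟩ := mem_padicForms_t21_iff.1 hx
  obtain ⟨F, hF, ⟨e⟩⟩ := PadicExtension.exists_isUnramified (monic_monicQuadratic b c)
    (irreducible_map_monicQuadratic hroot) (natDegree_monicQuadratic b c)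
  exact ⟨F, hF, h.correspondsTo_iff.2
    ((correspondsTo_adjoinRoot_monicQuadratic_prod b c).of_algEquiv (e.symm.prodCongr .refl))⟩

theorem exists_not_isUnramified_of_mem_t121max (hx : x ∈ padicForms p .t121max) :
    ∃ F : PadicExtension.{u} p 2, ¬ F.IsUnramified ∧ x.CorrespondsTo (F.integers × ℤ_[p]) := by
  obtain ⟨b, c, h, hb, hc, hc2⟩ := mem_padicForms_t121max_iff.1 hx
  obtain ⟨F, hF, ⟨e⟩⟩ := PadicExtension.exists_not_isUnramified (monic_monicQuadratic b c)
    (by rw [natDegree_monicQuadratic]) (isEisensteinAt_monicQuadratic hb hc hc2)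
    (natDegree_monicQuadratic b c)
  exact ⟨F, hF, h.correspondsTo_iff.2
    ((correspondsTo_adjoinRoot_monicQuadratic_prod b c).of_algEquiv (e.symm.prodCongr .refl))⟩

theorem correspondsTo_fin_three_iff :
    x.CorrespondsTo (Fin 3 → ℤ_[p]) ↔ x ∈ padicForms p .t111 :=
  ⟨fun h => mem_padicForms_t111_iff.2 (h.isEquiv correspondsTo_fin_three),
    fun h => (mem_padicForms_t111_iff.1 h).correspondsTo_iff.2 correspondsTo_fin_three⟩

/-- A form with a linear factor over `ℤ_p` does not correspond to a domain. -/
theorem not_correspondsTo_zero_one (b c : ℤ_[p]) {A : Type*} [CommRing A] [IsDomain A]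
    [Algebra ℤ_[p] A] : ¬ (⟨0, 1, b, c⟩ : BinaryCubicForm ℤ_[p]).CorrespondsTo A := by
  intro h
  obtain ⟨e⟩ := (correspondsTo_adjoinRoot_monicQuadratic_prod b c)
  obtain ⟨e'⟩ := h
  let g := e'.symm.trans e
  -- Orthogonal idempotents of the product give zero divisors in `A`.
  have h1 : g.symm (1, 0) * g.symm (0, 1) = 0 := by
    rw [← map_mul, Prod.mk_mul_mk, mul_zero, zero_mul, ← Prod.zero_eq_mk, map_zero]
  have hne : Nontrivial (AdjoinRoot (monicQuadratic b c)) :=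
    AdjoinRoot.nontrivial _ fun h0 => by
      have := natDegree_eq_of_degree_eq_some (n := 0) h0
      rw [natDegree_monicQuadratic] at this
      norm_num at this
  rcases mul_eq_zero.1 h1 with h | h <;>
  · rw [EmbeddingLike.map_eq_zero_iff] at h
    simp at h

end BinaryCubicForm

/-! ### Types of the integer rings of quadratic and cubic extensions, and uniqueness of the
unramified ones. -/

section Quadratic

open Polynomial BinaryCubicForm

variable {p : ℕ} [Fact p.Prime]

/-- A finite free algebra of rank two generated by `θ` with `θ² = b θ - c`. -/
theorem nonempty_adjoinRoot_monicQuadratic_algEquiv {A : Type*} [CommRing A] [Algebra ℤ_[p] A]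
    [Module.Free ℤ_[p] A] [Module.Finite ℤ_[p] A] (h2 : Module.finrank ℤ_[p] A = 2) {θ : A}
    (hθ : ∀ a : A, ∃ u v, a = algebraMap ℤ_[p] A u + algebraMap ℤ_[p] A v * θ) {b c : ℤ_[p]}
    (h : θ ^ 2 - algebraMap ℤ_[p] A b * θ + algebraMap ℤ_[p] A c = 0) :
    Nonempty (AdjoinRoot (monicQuadratic b c) ≃ₐ[ℤ_[p]] A) := by
  have hf := monic_monicQuadratic b c
  have := hf.finite_adjoinRoot
  have := hf.free_adjoinRoot
  let g : AdjoinRoot (monicQuadratic b c) →ₐ[ℤ_[p]] A :=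
    AdjoinRoot.liftAlgHom _ (Algebra.ofId _ _) θ (by
      simpa [monicQuadratic, Algebra.ofId_apply] using h)
  refine ⟨AlgEquiv.ofBijective g (LinearMap.bijective_of_surjective_of_finrank_eq
    (by rw [AdjoinRoot.finrank_eq_natDegree hf, natDegree_monicQuadratic, h2]) g.toLinearMap ?_)⟩
  intro a
  obtain ⟨u, v, rfl⟩ := hθ a
  refine ⟨algebraMap _ _ u + algebraMap _ _ v * AdjoinRoot.root _, ?_⟩
  rw [AlgHom.toLinearMap_apply, map_add, map_mul, AlgHom.commutes, AlgHom.commutes, AdjoinRoot.liftAlgHom_root]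

namespace PadicExtension

/-- The integer ring of a quadratic extension is generated by a root of a quadratic polynomial
which is irreducible modulo `p` or Eisenstein. -/
theorem exists_integers_algEquiv_monicQuadratic (F : PadicExtension.{u} p 2) :
    ∃ b c : ℤ_[p], Nonempty (AdjoinRoot (monicQuadratic b c) ≃ₐ[ℤ_[p]] F.integers) ∧
      ((∀ t, ¬ (p : ℤ_[p]) ∣ t ^ 2 + b * t + c) ∨
        ((p : ℤ_[p]) ∣ b ∧ (p : ℤ_[p]) ∣ c ∧ ¬ (p : ℤ_[p]) ^ 2 ∣ c)) := by
  have hfin := F.finrank_integers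
  obtain ⟨B, hB⟩ := exists_basis_zero_eq_one
    (Module.finBasisOfFinrankEq ℤ_[p] F.integers hfin)
  set θ := B 1 with hθ
  have hspan (a : F.integers) :
      ∃ u v, a = algebraMap ℤ_[p] F.integers u + algebraMap ℤ_[p] F.integers v * θ := by
    refine ⟨B.repr a 0, B.repr a 1, ?_⟩
    conv_lhs => rw [← B.sum_repr a]
    rw [Fin.sum_univ_two, hB, Algebra.smul_def, Algebra.smul_def, mul_one]
  have hne (s : ℤ_[p]) : θ ≠ algebraMap ℤ_[p] F.integers s := by
    intro h
    rw [Algebra.algebraMap_eq_smul_one, ← hB] at h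
    have := congrArg (fun z => B.repr z 1) h
    simp [hθ] at this
  obtain ⟨c', b, hbc⟩ := hspan (θ ^ 2)
  obtain ⟨c, rfl⟩ : ∃ c, c' = -c := ⟨-c', (neg_neg _).symm⟩
  have heq : θ ^ 2 - algebraMap ℤ_[p] F.integers b * θ + algebraMap ℤ_[p] F.integers c = 0 := by
    rw [hbc, map_neg]; ring
  have hshift (t : ℤ_[p]) :
      Nonempty (AdjoinRoot (monicQuadratic (b + 2 * t) (t ^ 2 + b * t + c)) ≃ₐ[ℤ_[p]]
        F.integers) := by
    refine nonempty_adjoinRoot_monicQuadratic_algEquiv hfin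
      (θ := θ + algebraMap ℤ_[p] F.integers t) (fun a => ?_) ?_
    · obtain ⟨u, v, rfl⟩ := hspan a
      exact ⟨u - v * t, v, by rw [map_sub, map_mul]; ring⟩
    · simp only [map_add, map_mul, map_pow, map_ofNat]
      linear_combination heq
  by_cases hroot : ∃ t, (p : ℤ_[p]) ∣ t ^ 2 + b * t + c
  · obtain ⟨t, ht⟩ := hroot
    -- A simple root modulo `p` would lift to `ℤ_p` and factor the equation of `θ`, forcing `θ` into
    -- `ℤ_p`.
    have hb : (p : ℤ_[p]) ∣ b + 2 * t := by
      by_contra h'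
      obtain ⟨s, hs, -⟩ := PadicInt.exists_root_of_dvd c b 1 0 t (by convert ht using 1; ring)
        (by convert h' using 2; ring)
      have h3 : (θ - algebraMap ℤ_[p] F.integers (-s)) *
          (θ - algebraMap ℤ_[p] F.integers (b + s)) = 0 := by
        have h4 := congrArg (algebraMap ℤ_[p] F.integers) hs
        simp only [map_add, map_mul, map_pow, map_ofNat, map_neg, map_zero, map_one] at h4 ⊢
        linear_combination heq - h4
      rcases mul_eq_zero.1 h3 with h | h
      · exact hne _ (sub_eq_zero.1 h)
      · exact hne _ (sub_eq_zero.1 h)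
    refine ⟨_, _, hshift t, .inr ⟨hb, ht, fun hc2 => ?_⟩⟩
    obtain ⟨e⟩ := hshift t
    -- If `p²` divided the constant term, the form of `𝒪_F × ℤ_p` would be reducible, against
    -- maximality.
    refine (isMaximalCubicRing_integers_prod F).not_isReducible
      ((correspondsTo_adjoinRoot_monicQuadratic_prod _ _).of_algEquiv (e.prodCongr .refl)) ?_
    obtain ⟨β, hβ⟩ := hb
    obtain ⟨γ, hγ⟩ := hc2
    refine .inr ⟨0, 1, β, γ, ?_⟩
    rw [hβ, hγ, sq, mul_assoc]
    exact .refl _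
  · push Not at hroot
    exact ⟨b, c, nonempty_adjoinRoot_monicQuadratic_algEquiv hfin hspan heq, .inl hroot⟩

/-- The two kinds of quadratic extensions. -/
theorem quadratic_cases (F : PadicExtension.{u} p 2) {x : BinaryCubicForm ℤ_[p]}
    (hx : x.CorrespondsTo (F.integers × ℤ_[p])) :
    (x ∈ padicForms p .t21 ∧ F.IsUnramified ∧ ∃ f : ℤ_[p][X], f.Monic ∧ f.natDegree = 2 ∧
      Irreducible (f.map (residueMap p)) ∧ Nonempty (F.integers ≃ₐ[ℤ_[p]] AdjoinRoot f)) ∨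
    (x ∈ padicForms p .t121max ∧ ¬ F.IsUnramified) := by
  -- Starting from a generator of `𝒪_F` rather than from the type of `x` avoids recovering `F` from
  -- the product ring.
  obtain ⟨b, c, ⟨e⟩, h⟩ := F.exists_integers_algEquiv_monicQuadratic
  have hxy := hx.isEquiv
    ((correspondsTo_adjoinRoot_monicQuadratic_prod b c).of_algEquiv (e.prodCongr .refl))
  have hf := monic_monicQuadratic b c
  have hd := natDegree_monicQuadratic b c
  rcases h with h | ⟨hb, hc, hc2⟩
  · have hi := irreducible_map_monicQuadratic h
    exact .inl ⟨mem_padicForms_t21_iff.2 ⟨b, c, hxy, h⟩, isUnramified_of_algEquiv hf hi e.symm,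
      _, hf, hd, hi, ⟨e.symm⟩⟩
  · exact .inr ⟨mem_padicForms_t121max_iff.2 ⟨b, c, hxy, hb, hc, hc2⟩,
      not_isUnramified_of_algEquiv hf hd.ge (isEisensteinAt_monicQuadratic hb hc hc2) e.symm⟩

/-- The two kinds of cubic extensions. -/
theorem cubic_cases (L : PadicExtension.{u} p 3) {x : BinaryCubicForm ℤ_[p]}
    (hx : x.CorrespondsTo L.integers) :
    (x ∈ padicForms p .t3 ∧ L.IsUnramified ∧ ∃ f : ℤ_[p][X], f.Monic ∧ f.natDegree = 3 ∧
      Irreducible (f.map (residueMap p)) ∧ Nonempty (L.integers ≃ₐ[ℤ_[p]] AdjoinRoot f)) ∨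
    (x ∈ padicForms p .t13max ∧ ¬ L.IsUnramified) := by
  obtain ⟨σ, hσ⟩ := (isMaximalCubicRing_integers L).exists_mem_padicForms hx
  -- The integer ring is a domain, which excludes the three types with a linear factor over `ℤ_p`.
  have hne {b c : ℤ_[p]} (h : IsEquiv x ⟨0, 1, b, c⟩) : False :=
    not_correspondsTo_zero_one b c (h.correspondsTo_iff.1 hx)
  have halg {b c d : ℤ_[p]} (h : IsEquiv x ⟨1, b, c, d⟩) :
      Nonempty (L.integers ≃ₐ[ℤ_[p]] AdjoinRoot (monicCubic b c d)) :=
    (h.correspondsTo_iff.1 hx).elim fun e =>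
      (correspondsTo_adjoinRoot_monicCubic b c d).map fun e' => e.symm.trans e'
  cases σ with
  | t3 =>
    obtain ⟨b, c, d, h, hroot⟩ := mem_padicForms_t3_iff.1 hσ
    obtain ⟨e⟩ := halg h
    have hi := irreducible_map_monicCubic hroot
    exact .inl ⟨hσ, isUnramified_of_algEquiv (monic_monicCubic b c d) hi e, _,
      monic_monicCubic b c d, natDegree_monicCubic b c d, hi, ⟨e⟩⟩
  | t13max =>
    obtain ⟨b, c, d, h, hb, hc, hd, hd2⟩ := mem_padicForms_t13max_iff.1 hσ
    obtain ⟨e⟩ := halg h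
    exact .inr ⟨hσ, not_isUnramified_of_algEquiv (monic_monicCubic b c d)
      (by rw [natDegree_monicCubic]; norm_num) (isEisensteinAt_monicCubic hb hc hd hd2) e⟩
  | t21 =>
    obtain ⟨b, c, h, -⟩ := mem_padicForms_t21_iff.1 hσ
    exact (hne h).elim
  | t111 => exact (hne (mem_padicForms_t111_iff.1 hσ)).elim
  | t121max =>
    obtain ⟨b, c, h, -⟩ := mem_padicForms_t121max_iff.1 hσ
    exact (hne h).elim

/-- Both rings are generated by a root of a cubic polynomial irreducible modulo `p`, so
`nonempty_adjoinRoot_algEquiv` identifies them. -/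
theorem nonempty_integers_algEquiv_of_cubic {L L' : PadicExtension.{u} p 3}
    (h : L.IsUnramified) (h' : L'.IsUnramified) :
    Nonempty (L.integers ≃ₐ[ℤ_[p]] L'.integers) := by
  obtain ⟨x, hx⟩ := (isMaximalCubicRing_integers L).isCubicRing.exists_correspondsTo
  obtain ⟨y, hy⟩ := (isMaximalCubicRing_integers L').isCubicRing.exists_correspondsTo
  obtain ⟨-, -, f, hf, hfd, hfi, ⟨e⟩⟩ := (L.cubic_cases hx).resolve_right (·.2 h)
  obtain ⟨-, -, g, hg, hgd, hgi, ⟨e'⟩⟩ := (L'.cubic_cases hy).resolve_right (·.2 h')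
  obtain ⟨e''⟩ := nonempty_adjoinRoot_algEquiv hg hf hgi hfi (hgd.trans hfd.symm)
  exact ⟨(e.trans e'').trans e'.symm⟩

theorem nonempty_integers_algEquiv_of_quadratic {F F' : PadicExtension.{u} p 2}
    (h : F.IsUnramified) (h' : F'.IsUnramified) :
    Nonempty (F.integers ≃ₐ[ℤ_[p]] F'.integers) := by
  obtain ⟨x, hx⟩ := (isMaximalCubicRing_integers_prod F).isCubicRing.exists_correspondsTo
  obtain ⟨y, hy⟩ := (isMaximalCubicRing_integers_prod F').isCubicRing.exists_correspondsTo
  obtain ⟨-, -, f, hf, hfd, hfi, ⟨e⟩⟩ := (F.quadratic_cases hx).resolve_right (·.2 h)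
  obtain ⟨-, -, g, hg, hgd, hgi, ⟨e'⟩⟩ := (F'.quadratic_cases hy).resolve_right (·.2 h')
  obtain ⟨e''⟩ := nonempty_adjoinRoot_algEquiv hg hf hgi hfi (hgd.trans hfd.symm)
  exact ⟨(e.trans e'').trans e'.symm⟩

end PadicExtension

end Quadratic

/-! ### Assembly of the classification. -/

section Main

open BinaryCubicForm

variable {p : ℕ} [Fact p.Prime]

/-- A maximal cubic ring is isomorphic to one of the rings attached to the five types. -/
theorem IsMaximalCubicRing.cases {R : Type u} [CommRing R] [Algebra ℤ_[p] R]
    (hR : IsMaximalCubicRing p R) :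
    (∃ L : PadicExtension.{u} p 3, Nonempty (R ≃ₐ[ℤ_[p]] L.integers)) ∨
      (∃ F : PadicExtension.{u} p 2, Nonempty (R ≃ₐ[ℤ_[p]] F.integers × ℤ_[p])) ∨
      Nonempty (R ≃ₐ[ℤ_[p]] (Fin 3 → ℤ_[p])) := by
  obtain ⟨x, hx⟩ := hR.isCubicRing.exists_correspondsTo
  obtain ⟨σ, hσ⟩ := hR.exists_mem_padicForms hx
  have hiso {A : Type u} [CommRing A] [Algebra ℤ_[p] A] (h : x.CorrespondsTo A) :
      Nonempty (R ≃ₐ[ℤ_[p]] A) := hx.elim fun e => h.map fun e' => e.symm.trans e'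
  cases σ with
  | t3 =>
    obtain ⟨L, -, h⟩ := exists_isUnramified_of_mem_t3.{u} hσ
    exact .inl ⟨L, hiso h⟩
  | t13max =>
    obtain ⟨L, -, h⟩ := exists_not_isUnramified_of_mem_t13max.{u} hσ
    exact .inl ⟨L, hiso h⟩
  | t21 =>
    obtain ⟨F, -, h⟩ := exists_isUnramified_of_mem_t21.{u} hσ
    exact .inr (.inl ⟨F, hiso h⟩)
  | t121max =>
    obtain ⟨F, -, h⟩ := exists_not_isUnramified_of_mem_t121max.{u} hσ
    exact .inr (.inl ⟨F, hiso h⟩)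
  | t111 =>
    exact .inr (.inr (hx.elim fun e => (correspondsTo_fin_three_iff.2 hσ).map fun e' =>
      e.symm.trans e'))

/-- If the forms of type `σ` are those corresponding to a fixed ring, they form one orbit. -/
theorem BinaryCubicForm.padicForms_eq_orbit {σ : MaximalType} {A : Type*} [CommRing A]
    [Algebra ℤ_[p] A] (h : ∀ x : BinaryCubicForm ℤ_[p], x.CorrespondsTo A ↔ x ∈ padicForms p σ)
    {x : BinaryCubicForm ℤ_[p]} (hx : x.CorrespondsTo A) :
    padicForms p σ = MulAction.orbit (GL (Fin 2) ℤ_[p]) x := by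
  ext y
  rw [← h]
  exact ⟨fun hy => hx.isEquiv hy, fun hy => (IsEquiv.correspondsTo_iff hy).1 hx⟩

end Main

theorem mainTheorem10 (p : ℕ) [Fact p.Prime] :
    -- the unramified cubic extension `L` and the unramified quadratic extension `F` of `ℚ_p`
    ∃ (L : PadicExtension.{u} p 3) (F : PadicExtension.{u} p 2),
      (L.IsUnramified ∧ ∀ L₁ : PadicExtension.{u} p 3, L₁.IsUnramified →
        Nonempty (L₁.carrier ≃ₐ[ℚ_[p]] L.carrier)) ∧
      (F.IsUnramified ∧ ∀ F₁ : PadicExtension.{u} p 2, F₁.IsUnramified →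
        Nonempty (F₁.carrier ≃ₐ[ℚ_[p]] F.carrier)) ∧
      -- the maximal cubic rings
      (∀ (R : Type u) [CommRing R] [Algebra ℤ_[p] R],
        IsMaximalCubicRing p R ↔
          (Nonempty (R ≃ₐ[ℤ_[p]] L.integers) ∨
            Nonempty (R ≃ₐ[ℤ_[p]] F.integers × ℤ_[p]) ∨
            Nonempty (R ≃ₐ[ℤ_[p]] (Fin 3 → ℤ_[p])) ∨
            (∃ L' : PadicExtension.{u} p 3, ¬ L'.IsUnramified ∧
              Nonempty (R ≃ₐ[ℤ_[p]] L'.integers)) ∨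
            (∃ F' : PadicExtension.{u} p 2, ¬ F'.IsUnramified ∧
              Nonempty (R ≃ₐ[ℤ_[p]] F'.integers × ℤ_[p])))) ∧
      -- the corresponding forms
      (∀ x : BinaryCubicForm ℤ_[p],
        (x.CorrespondsTo L.integers ↔ x ∈ padicForms p .t3) ∧
        (x.CorrespondsTo (F.integers × ℤ_[p]) ↔ x ∈ padicForms p .t21) ∧
        (x.CorrespondsTo (Fin 3 → ℤ_[p]) ↔ x ∈ padicForms p .t111) ∧
        ((∃ L' : PadicExtension.{u} p 3, ¬ L'.IsUnramified ∧ x.CorrespondsTo L'.integers) ↔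
          x ∈ padicForms p .t13max) ∧
        ((∃ F' : PadicExtension.{u} p 2, ¬ F'.IsUnramified ∧
            x.CorrespondsTo (F'.integers × ℤ_[p])) ↔
          x ∈ padicForms p .t121max)) ∧
      -- single orbits
      (∀ σ ∈ ({.t3, .t21, .t111} : Set MaximalType),
        ∃ x : BinaryCubicForm ℤ_[p], padicForms p σ = MulAction.orbit (GL (Fin 2) ℤ_[p]) x) := by
  obtain ⟨f, hf, hfd, hfi⟩ := exists_monic_irreducible_map p 3 (by norm_num)
  obtain ⟨g, hg, hgd, hgi⟩ := exists_monic_irreducible_map p 2 (by norm_num)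
  obtain ⟨L, hL, -⟩ := PadicExtension.exists_isUnramified.{u} hf hfi hfd
  obtain ⟨F, hF, -⟩ := PadicExtension.exists_isUnramified.{u} hg hgi hgd
  -- A form of type `(3)` gives some unramified cubic integer ring, and uniqueness identifies it
  -- with that of `L`. Conversely, unramifiedness excludes type `(1³_max)`.
  have h3 (x : BinaryCubicForm ℤ_[p]) : x.CorrespondsTo L.integers ↔ x ∈ padicForms p .t3 := by
    refine ⟨fun hx => ((L.cubic_cases hx).resolve_right (·.2 hL)).1, fun hx => ?_⟩
    obtain ⟨L', hL', h⟩ := BinaryCubicForm.exists_isUnramified_of_mem_t3.{u} hx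
    exact (PadicExtension.nonempty_integers_algEquiv_of_cubic hL' hL).elim h.of_algEquiv
  have h21 (x : BinaryCubicForm ℤ_[p]) :
      x.CorrespondsTo (F.integers × ℤ_[p]) ↔ x ∈ padicForms p .t21 := by
    refine ⟨fun hx => ((F.quadratic_cases hx).resolve_right (·.2 hF)).1, fun hx => ?_⟩
    obtain ⟨F', hF', h⟩ := BinaryCubicForm.exists_isUnramified_of_mem_t21.{u} hx
    exact (PadicExtension.nonempty_integers_algEquiv_of_quadratic hF' hF).elim
      fun e => h.of_algEquiv (e.prodCongr .refl)
  refine ⟨L, F, ⟨hL, fun L₁ h => PadicExtension.nonempty_algEquiv_of_integers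
    (PadicExtension.nonempty_integers_algEquiv_of_cubic h hL)⟩, ⟨hF, fun F₁ h =>
    PadicExtension.nonempty_algEquiv_of_integers
      (PadicExtension.nonempty_integers_algEquiv_of_quadratic h hF)⟩, fun R _ _ => ⟨fun hR => ?_, ?_⟩,
    fun x => ⟨h3 x, h21 x, BinaryCubicForm.correspondsTo_fin_three_iff,
      ⟨?_, BinaryCubicForm.exists_not_isUnramified_of_mem_t13max⟩,
      ⟨?_, BinaryCubicForm.exists_not_isUnramified_of_mem_t121max⟩⟩, ?_⟩
  · rcases hR.cases with ⟨L', ⟨e⟩⟩ | ⟨F', ⟨e⟩⟩ | he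
    · by_cases h : L'.IsUnramified
      · exact .inl ((PadicExtension.nonempty_integers_algEquiv_of_cubic h hL).map e.trans)
      · exact .inr (.inr (.inr (.inl ⟨L', h, ⟨e⟩⟩)))
    · by_cases h : F'.IsUnramified
      · exact .inr (.inl ((PadicExtension.nonempty_integers_algEquiv_of_quadratic h hF).map
          fun e' => e.trans (e'.prodCongr .refl)))
      · exact .inr (.inr (.inr (.inr ⟨F', h, ⟨e⟩⟩)))
    · exact .inr (.inr (.inl he))
  · rintro (⟨⟨e⟩⟩ | ⟨⟨e⟩⟩ | ⟨⟨e⟩⟩ | ⟨L', -, ⟨e⟩⟩ | ⟨F', -, ⟨e⟩⟩)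
    · exact (isMaximalCubicRing_integers L).of_algEquiv e
    · exact (isMaximalCubicRing_integers_prod F).of_algEquiv e
    · exact isMaximalCubicRing_ulift_fin_three.of_algEquiv (e.trans ULift.algEquiv.symm)
    · exact (isMaximalCubicRing_integers L').of_algEquiv e
    · exact (isMaximalCubicRing_integers_prod F').of_algEquiv e
  · rintro ⟨L', hL', hx⟩
    exact ((L'.cubic_cases hx).resolve_left (hL' ·.2.1)).1
  · rintro ⟨F', hF', hx⟩
    exact ((F'.quadratic_cases hx).resolve_left (hF' ·.2.1)).1
  · rintro σ (rfl | rfl | rfl)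
    · obtain ⟨x, hx⟩ := (isMaximalCubicRing_integers L).isCubicRing.exists_correspondsTo
      exact ⟨x, BinaryCubicForm.padicForms_eq_orbit h3 hx⟩
    · obtain ⟨x, hx⟩ := (isMaximalCubicRing_integers_prod F).isCubicRing.exists_correspondsTo
      exact ⟨x, BinaryCubicForm.padicForms_eq_orbit h21 hx⟩
    · exact ⟨_, BinaryCubicForm.padicForms_eq_orbit
        (fun _ => BinaryCubicForm.correspondsTo_fin_three_iff)
        BinaryCubicForm.correspondsTo_fin_three⟩
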